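/- Let $X$ be a locally compact Hausdorff space with an action of a finite group $W$ by homeomorphisms, write $(\alpha_w b)(x)=b(w^{-1}x)$ for functions $b$ on $X$, and let $\gamma:W\times W\to C(X,\mathbb T)$ be such that $(\alpha,\gamma)$ is a twisted action of $W$ on $C_0(X)$: $\alpha_u(\gamma(v,w))\,\gamma(u,vw)=\gamma(uv,w)\,\gamma(u,v)$ and $\gamma(1,w)=\gamma(w,1)=1$ for all $u,v,w\in W$. Write $\gamma_x(v,w)=\gamma(v,w)(x)$. Let $C_0(X)\rtimes_\gamma W=\{\sum_{w\in W} b_w w \mid b_w\in C_0(X)\}$ be the twisted crossed product $C^*$-algebra, with $b_1w_1\cdot b_2w_2=b_1\alpha_{w_1}(b_2)\gamma(w_1,w_2)\,w_1w_2$, $(bw)^*=\gamma(w^{-1},w)^*\alpha_{w^{-1}}(b^*)\,w^{-1}$, and its unique $C^*$-norm. Let $E$ be a Hilbert $C_0(X)$-module with inner product $\langle\,\cdot\mid\cdot\,\rangle$, equipped with an $(\alpha,\gamma)$-twisted action of $W$, i.e. a map $U:W\to \mathrm{GL}(E)$ with $U_w(\xi b)=U_w(\xi)\alpha_w(b)$,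 $\langle U_w\xi\mid U_w\eta\rangle=\alpha_w\langle\xi\mid\eta\rangle$ and $U_vU_w(\xi)=U_{vw}(\xi)\gamma(v,w)^*$ for all $v,w\in W$, $\xi,\eta\in E$, $b\in C_0(X)$. For $\xi,\eta\in E$, $b\in C_0(X)$ and $w\in W$ put $$\xi\cdot bw=U_w^{-1}(\xi b),\qquad \langle\!\langle \xi\mid\eta\rangle\!\rangle=\sum_{w\in W}\langle\xi\mid U_w\eta\rangle\, w\in C_0(X)\rtimes_\gamma W,$$ and let $C(X,E,W)$ be the closed linear span of all $\langle\!\langle \xi\mid\eta\rangle\!\rangle$ in $C_0(X)\rtimes_\gamma W$. Let $\mathrm K_{C_0(X)}(E)$ be the $C^*$-algebra of compact operators on $E$ (the norm closure of the span of the operators $\zeta\mapsto\xi\langle\eta\mid\zeta\rangle$), and $\mathrm K_{C_0(X)}(E)^W$ the $C^*$-subalgebra of those $k$ that commute with every $U_w$. For $x\in X$ let $W_x$ be the stabiliser of $x$ in $W$, let $E_x=E\otimes_{C_0(X)}\mathbb C_x$ be the fibre Hilbert space, where $\mathbb{C}_x$ is $\mathbb{C}$ with $C_0(X)$ acting by evaluation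 at $x$, let $\xi(x)=\xi\otimes 1\in E_x$ for $\xi\in E$, and let $I_{w,x}:E_x\to E_{wx}$ be the unitary operator with $I_{w,x}(\xi(x))=(U_w\xi)(wx)$. Let $W'_x$ be the set of $w\in W_x$ for which $I_{w,x}$ is a scalar operator, and for $w\in W'_x$ let $\iota_{w,x}\in\mathbb T$ be the scalar with $I_{w,x}=\iota_{w,x}\,\mathrm{id}_{E_x}$ (with $\iota_{w,x}=1$ if $E_x=0$). A unitary $\gamma_x$-representation of $W_x$ is a map $\pi$ from $W_x$ to the unitary group of a Hilbert space $H_\pi$ with $\pi(v)\pi(w)=\gamma_x(v,w)\pi(vw)$ for all $v,w\in W_x$. Suppose that $E$ satisfies the completeness condition: for every $x\in X$, every irreducible unitary $\gamma_x$-representation $\pi$ of $W_x$ with $\pi(w')=\overline{\iota_{w',x}}\,\mathrm{id}_{H_\pi}$ for all $w'\in W'_x$ is isomorphic to a subrepresentation of the contragredient (complex conjugate) of $w\mapsto I_{w,x}$, $w\in W_x$. Then $C(X,E,W)$ is a closed two-sided ideal of $C_0(X)\rtimes_\gamma W$, it is given by $$C(X,E,W)=\Big\{\sum_{w\in W} b_w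 w\ \Big|\ b_{w'w}(x)=\iota_{w',x}\,\gamma_x(w',w)\,b_w(x)\ \text{ for all } x\in X,\ w'\in W'_x,\ w\in W\Big\},$$ and $E$, with the natural left action of $\mathrm K_{C_0(X)}(E)^W$, the right action $\xi\cdot bw$ above (extended additively and restricted to $C(X,E,W)$) and the right inner product $\langle\!\langle\,\cdot\mid\cdot\,\rangle\!\rangle$, is a Morita equivalence (imprimitivity bimodule) between the $C^*$-algebras $\mathrm K_{C_0(X)}(E)^W$ and $C(X,E,W)$. -/

import Mathlib

open scoped ZeroAtInfty

noncomputable section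

set_option linter.unusedSectionVars false

namespace TwistedMorita

/-! ### The commutative C⋆-algebra `C₀(X)` and the action of `W` on it -/

section Functions

variable {W X : Type*} [TopologicalSpace X]

instance : PartialOrder C₀(X, ℂ) := CStarAlgebra.spectralOrder _

instance : StarOrderedRing C₀(X, ℂ) := CStarAlgebra.spectralOrderedRing _

/-- The product of a continuous `𝕋`-valued function with an element of `C₀(X)`. -/
def twist (c : C(X, Circle)) (b : C₀(X, ℂ)) : C₀(X, ℂ) where
  toFun x := (c x : ℂ) * b x
  continuous_toFun := by fun_prop
  zero_at_infty' := by
    rw [tendsto_zero_iff_norm_tendsto_zero]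
    simpa [Circle.norm_coe] using (tendsto_zero_iff_norm_tendsto_zero.mp (zero_at_infty b))

@[simp] theorem twist_apply (c : C(X, Circle)) (b : C₀(X, ℂ)) (x : X) :
    twist c b x = (c x : ℂ) * b x := rfl

variable [Group W] [MulAction W X] [ContinuousConstSMul W X]

/-- The induced action of `W` on functions: `(α_w b)(x) = b(w⁻¹x)`. -/
def alpha (w : W) (b : C₀(X, ℂ)) : C₀(X, ℂ) where
  toFun x := b (w⁻¹ • x)
  continuous_toFun := by fun_prop
  zero_at_infty' :=
    (zero_at_infty b).comp (Homeomorph.smul (α := X) w⁻¹).isClosedEmbedding.tendsto_cocompact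

@[simp] theorem alpha_apply (w : W) (b : C₀(X, ℂ)) (x : X) :
    alpha w b x = b (w⁻¹ • x) := rfl

theorem continuous_twist (c : C(X, Circle)) : Continuous (twist c) := by
  refine LipschitzWith.continuous (K := 1) (LipschitzWith.of_dist_le_mul fun f g => ?_)
  rw [NNReal.coe_one, one_mul, ← ZeroAtInftyContinuousMap.dist_toBCF_eq_dist,
    ← ZeroAtInftyContinuousMap.dist_toBCF_eq_dist,
    BoundedContinuousFunction.dist_le dist_nonneg]
  intro x
  refine le_trans (le_of_eq ?_) (BoundedContinuousFunction.dist_coe_le_dist x)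
  simp [dist_eq_norm, ← mul_sub, Circle.norm_coe]

theorem continuous_alpha (w : W) : Continuous (alpha w : C₀(X, ℂ) → C₀(X, ℂ)) := by
  refine LipschitzWith.continuous (K := 1) (LipschitzWith.of_dist_le_mul fun f g => ?_)
  rw [NNReal.coe_one, one_mul, ← ZeroAtInftyContinuousMap.dist_toBCF_eq_dist,
    ← ZeroAtInftyContinuousMap.dist_toBCF_eq_dist,
    BoundedContinuousFunction.dist_le dist_nonneg]
  intro x
  exact BoundedContinuousFunction.dist_coe_le_dist (f := f.toBCF) (g := g.toBCF) (w⁻¹ • x)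

end Functions

/-! ### Twisted actions and the twisted crossed product -/

/-- A map `γ : W × W → C(X, 𝕋)` which, together with the action `α` of `W` on `C₀(X)` induced by an
action of `W` on `X`, is a twisted action: `α_u(γ(v,w)) γ(u,vw) = γ(uv,w) γ(u,v)` and
`γ(1,w) = γ(w,1) = 1`. The remaining axioms `α_v(α_w(b)) = γ(v,w) α_{vw}(b) γ(v,w)^*` and `α_1 = 1`
hold automatically, as `C₀(X)` is commutative and `α` comes from an action on `X`. -/
structure TwistedAction (W X : Type*) [Group W] [TopologicalSpace X] [MulAction W X] where
  γ : W → W → C(X, Circle)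
  cocycle : ∀ (u v w : W) (x : X), γ v w (u⁻¹ • x) * γ u (v * w) x = γ (u * v) w x * γ u v x
  one_left : ∀ (w : W) (x : X), γ 1 w x = 1
  one_right : ∀ (w : W) (x : X), γ w 1 x = 1

/-- The twisted crossed product `C₀(X) ⋊_γ W`: the element `∑_w b_w w` is the family `(b_w)_w`. -/
def CrossedProduct {W X : Type*} [Group W] [TopologicalSpace X] [MulAction W X]
    (_T : TwistedAction W X) : Type _ := W → C₀(X, ℂ)

namespace CrossedProduct

variable {W X : Type*} [Group W] [TopologicalSpace X] [MulAction W X] {T : TwistedAction W X}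

instance : AddCommGroup (CrossedProduct T) := inferInstanceAs (AddCommGroup (W → C₀(X, ℂ)))

instance : Module ℂ (CrossedProduct T) := inferInstanceAs (Module ℂ (W → C₀(X, ℂ)))

/-- The coefficient `b_w` of `∑_w b_w w`. -/
def coeff (f : CrossedProduct T) (w : W) : C₀(X, ℂ) := f w

/-- The element `∑_w b_w w` with given coefficients. -/
def mk (b : W → C₀(X, ℂ)) : CrossedProduct T := b

@[simp] theorem coeff_mk (b : W → C₀(X, ℂ)) (w : W) : coeff (mk b : CrossedProduct T) w = b w := rfl

@[ext] theorem ext {f g : CrossedProduct T} (h : ∀ w x, f.coeff w x = g.coeff w x) : f = g :=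
  funext fun w => ZeroAtInftyContinuousMap.ext (h w)

@[simp] theorem coeff_add (f g : CrossedProduct T) (w : W) :
    (f + g).coeff w = f.coeff w + g.coeff w := rfl

@[simp] theorem coeff_zero (w : W) : (0 : CrossedProduct T).coeff w = 0 := rfl

@[simp] theorem coeff_neg (f : CrossedProduct T) (w : W) : (-f).coeff w = -f.coeff w := rfl

@[simp] theorem coeff_sub (f g : CrossedProduct T) (w : W) :
    (f - g).coeff w = f.coeff w - g.coeff w := rfl

@[simp] theorem coeff_smul (c : ℂ) (f : CrossedProduct T) (w : W) :
    (c • f).coeff w = c • f.coeff w := rfl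

variable [ContinuousConstSMul W X] [Fintype W]

/-- The multiplication determined by `b₁w₁ · b₂w₂ = b₁ α_{w₁}(b₂) γ(w₁,w₂) w₁w₂`: the coefficient at
`u` collects the pairs `w₁ = w`, `w₂ = w⁻¹u`. -/
instance : Mul (CrossedProduct T) where
  mul f g := mk fun u => ∑ w, twist (T.γ w (w⁻¹ * u)) (f.coeff w * alpha w (g.coeff (w⁻¹ * u)))

/-- The involution determined by `(bw)^* = γ(w⁻¹,w)^* α_{w⁻¹}(b^*) w⁻¹`: the coefficient at `u` comes
from `w = u⁻¹`. -/
instance : Star (CrossedProduct T) where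
  star f := mk fun u => twist (T.γ u u⁻¹)⁻¹ (alpha u (star (f.coeff u⁻¹)))

theorem sum_apply {ι : Type*} (s : Finset ι) (f : ι → C₀(X, ℂ)) (x : X) :
    (∑ i ∈ s, f i) x = ∑ i ∈ s, f i x :=
  map_sum (⟨⟨fun b : C₀(X, ℂ) => b x, rfl⟩, fun _ _ => rfl⟩ : C₀(X, ℂ) →+ ℂ) f s

theorem mul_coeff (f g : CrossedProduct T) (u : W) (x : X) :
    (f * g).coeff u x =
      ∑ w, (T.γ w (w⁻¹ * u) x : ℂ) * (f.coeff w x * g.coeff (w⁻¹ * u) (w⁻¹ • x)) :=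
  sum_apply _ _ _

theorem star_coeff (f : CrossedProduct T) (u : W) (x : X) :
    (star f).coeff u x =
      starRingEnd ℂ (T.γ u u⁻¹ x : ℂ) * starRingEnd ℂ (f.coeff u⁻¹ (u⁻¹ • x)) := by
  rw [← Circle.coe_inv_eq_conj]
  rfl

/-- The matrix of `f` in the representation `bw (δ_v ⊗ h) = δ_{wv} ⊗ α_{wv}⁻¹(b γ(w,v)) h` on
`ℓ²(W) ⊗ H`, for a faithful representation of `C₀(X)` on a Hilbert space `H`: its entry in row `u`
and column `v` is `α_u⁻¹(b_w γ(w,v))`, where `w = uv⁻¹`. -/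
def toMatrix (f : CrossedProduct T) : CStarMatrix W W C₀(X, ℂ) :=
  CStarMatrix.ofMatrix fun u v => alpha u⁻¹ (twist (T.γ (u * v⁻¹) v) (f.coeff (u * v⁻¹)))

theorem toMatrix_apply (f : CrossedProduct T) (u v : W) (x : X) :
    toMatrix f u v x = (T.γ (u * v⁻¹) v (u • x) : ℂ) * f.coeff (u * v⁻¹) (u • x) := by
  change (T.γ (u * v⁻¹) v (u⁻¹⁻¹ • x) : ℂ) * f.coeff (u * v⁻¹) (u⁻¹⁻¹ • x) = _
  rw [inv_inv]

theorem matrix_ext {M N : CStarMatrix W W C₀(X, ℂ)} (h : ∀ u v x, M u v x = N u v x) : M = N := by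
  ext u v x
  exact h u v x

theorem toMatrix_injective : Function.Injective (toMatrix (T := T)) := by
  intro f g h
  ext w x
  have := congrArg (fun M : CStarMatrix W W C₀(X, ℂ) => M w 1 (w⁻¹ • x)) h
  simpa [toMatrix_apply, T.one_right] using this

theorem toMatrix_mul (f g : CrossedProduct T) : toMatrix (f * g) = toMatrix f * toMatrix g := by
  apply matrix_ext
  intro u v x
  rw [CStarMatrix.mul_apply, sum_apply, toMatrix_apply, mul_coeff, Finset.mul_sum]
  refine Fintype.sum_equiv ((Equiv.inv W).trans (Equiv.mulRight u)) _ _ fun w => ?_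
  have h := congrArg (fun z : Circle => (z : ℂ)) (T.cocycle w (w⁻¹ * (u * v⁻¹)) v (u • x))
  simp only [Equiv.trans_apply, Equiv.inv_apply, Equiv.coe_mulRight]
  rw [ZeroAtInftyContinuousMap.mul_apply, toMatrix_apply, toMatrix_apply]
  simp only [Circle.coe_mul, mul_inv_rev, inv_inv, mul_smul, mul_inv_cancel_left, mul_assoc,
    inv_mul_cancel, mul_one] at h ⊢
  linear_combination (-(f.coeff w (u • x) * g.coeff (w⁻¹ * (u * v⁻¹)) (w⁻¹ • u • x))) * h

theorem toMatrix_star (f : CrossedProduct T) : toMatrix (star f) = star (toMatrix f) := by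
  apply matrix_ext
  intro u v x
  rw [CStarMatrix.star_apply, toMatrix_apply, star_coeff, ZeroAtInftyContinuousMap.star_apply,
    toMatrix_apply]
  have h := congrArg (fun z : Circle => (z : ℂ)) (T.cocycle (u * v⁻¹) (v * u⁻¹) u (u • x))
  simp only [Circle.coe_mul, mul_inv_rev, inv_inv, mul_smul, mul_assoc,
    inv_mul_cancel, mul_one, inv_smul_smul, inv_mul_cancel_left, mul_inv_cancel, T.one_left,
    one_mul, star_mul', RCLike.star_def] at h ⊢
  rw [← h, map_mul]
  have h1 : (T.γ (u * v⁻¹) v (u • x) : ℂ) * starRingEnd ℂ (T.γ (u * v⁻¹) v (u • x) : ℂ) = 1 := by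
    rw [Complex.mul_conj, Circle.normSq_coe, Complex.ofReal_one]
  linear_combination (starRingEnd ℂ (T.γ (v * u⁻¹) u (v • x) : ℂ) *
    starRingEnd ℂ (f.coeff (v * u⁻¹) (v • x))) * h1

theorem toMatrix_add (f g : CrossedProduct T) : toMatrix (f + g) = toMatrix f + toMatrix g := by
  apply matrix_ext
  intro u v x
  rw [CStarMatrix.add_apply, ZeroAtInftyContinuousMap.add_apply]
  simp only [toMatrix_apply, coeff_add, ZeroAtInftyContinuousMap.add_apply, mul_add]

theorem toMatrix_smul (c : ℂ) (f : CrossedProduct T) : toMatrix (c • f) = c • toMatrix f := by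
  apply matrix_ext
  intro u v x
  rw [CStarMatrix.smul_apply, ZeroAtInftyContinuousMap.smul_apply]
  simp only [toMatrix_apply, coeff_smul, ZeroAtInftyContinuousMap.smul_apply, smul_eq_mul]
  ring

theorem toMatrix_zero : toMatrix (0 : CrossedProduct T) = 0 := by
  apply matrix_ext
  intro u v x
  rw [toMatrix_apply, coeff_zero]
  exact mul_zero _

instance : NonUnitalRing (CrossedProduct T) where
  left_distrib f g h := toMatrix_injective (by simp only [toMatrix_mul, toMatrix_add, mul_add])
  right_distrib f g h := toMatrix_injective (by simp only [toMatrix_mul, toMatrix_add, add_mul])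
  zero_mul f := toMatrix_injective (by simp only [toMatrix_mul, toMatrix_zero, zero_mul])
  mul_zero f := toMatrix_injective (by simp only [toMatrix_mul, toMatrix_zero, mul_zero])
  mul_assoc f g h := toMatrix_injective (by simp only [toMatrix_mul, mul_assoc])

instance : StarRing (CrossedProduct T) where
  star_involutive f := toMatrix_injective (by simp only [toMatrix_star, star_star])
  star_mul f g := toMatrix_injective (by
    rw [toMatrix_star, toMatrix_mul, toMatrix_mul, toMatrix_star, toMatrix_star]
    exact star_mul (toMatrix f) (toMatrix g))
  star_add f g := toMatrix_injective (by simp only [toMatrix_star, toMatrix_add, star_add])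

instance : StarModule ℂ (CrossedProduct T) where
  star_smul c f := toMatrix_injective (by simp only [toMatrix_star, toMatrix_smul, star_smul])

instance : IsScalarTower ℂ (CrossedProduct T) (CrossedProduct T) where
  smul_assoc c f g := toMatrix_injective (by
    simp only [smul_eq_mul, toMatrix_mul, toMatrix_smul, smul_mul_assoc])

instance : SMulCommClass ℂ (CrossedProduct T) (CrossedProduct T) where
  smul_comm c f g := toMatrix_injective (by
    simp only [smul_eq_mul, toMatrix_mul, toMatrix_smul, mul_smul_comm])

/-- The faithful representation `toMatrix` as a ring homomorphism. -/
def toMatrixHom : CrossedProduct T →ₙ+* CStarMatrix W W C₀(X, ℂ) where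
  toFun := toMatrix
  map_mul' := toMatrix_mul
  map_zero' := toMatrix_zero
  map_add' := toMatrix_add

/-- The C⋆-norm of the crossed product: the norm of the image under `toMatrix` in the C⋆-algebra of
`W × W` matrices over `C₀(X)`, whose C⋆-norm is the operator norm on `ℓ²(W) ⊗ H` for every faithful
representation of `C₀(X)` on `H`. -/
instance : NonUnitalNormedRing (CrossedProduct T) :=
  NonUnitalNormedRing.induced (CrossedProduct T) (CStarMatrix W W C₀(X, ℂ)) toMatrixHom
    toMatrix_injective

theorem norm_def (f : CrossedProduct T) : ‖f‖ = ‖toMatrix f‖ := rfl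

instance : NormedSpace ℂ (CrossedProduct T) where
  norm_smul_le c f := by 
    rw [norm_def, norm_def, toMatrix_smul]
    exact norm_smul_le c (toMatrix f)

instance : CStarRing (CrossedProduct T) where
  norm_mul_self_le f := by
    have h := CStarRing.norm_star_mul_self (x := toMatrix f)
    rw [← toMatrix_star, ← toMatrix_mul] at h
    exact h.ge

theorem isometry_toMatrix : Isometry (toMatrix (T := T)) :=
  AddMonoidHomClass.isometry_of_norm (toMatrixHom (T := T)) fun _ => rfl

instance : CompleteSpace (CrossedProduct T) := by
  refine isometry_toMatrix.isUniformInducing.completeSpace (IsClosed.isComplete ?_)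
  have hr : Set.range (toMatrix (T := T)) = {M : CStarMatrix W W C₀(X, ℂ) |
      ∀ u v, M u v = alpha u⁻¹ (twist (T.γ (u * v⁻¹) v) (alpha (u * v⁻¹) (M (u * v⁻¹) 1)))} := by
    ext M
    constructor
    · rintro ⟨f, rfl⟩ u v
      ext x
      simp [toMatrix_apply, T.one_right, smul_smul]
    · intro h
      refine ⟨mk fun w => alpha w (M w 1), ?_⟩
      apply CStarMatrix.ext
      intro u v
      exact (h u v).symm
  rw [hr]
  have hc : ∀ u v, Continuous fun M : CStarMatrix W W C₀(X, ℂ) => M u v := fun u v =>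
    (continuous_apply v).comp (continuous_apply u)
  simp only [Set.ofPred_forall]
  refine isClosed_iInter fun u => isClosed_iInter fun v => isClosed_eq (hc u v) ?_
  exact (continuous_alpha _).comp ((continuous_twist _).comp ((continuous_alpha _).comp (hc _ _)))

instance : NonUnitalCStarAlgebra (CrossedProduct T) where

end CrossedProduct

/-! ### Adjointable and compact operators on a Hilbert module -/

section Operators

variable (A E : Type*) [NonUnitalCStarAlgebra A] [PartialOrder A] [StarOrderedRing A]
  [NormedAddCommGroup E] [NormedSpace ℂ E] [SMul A E] [CStarModule A E]

/-- The algebra of adjointable operators on the Hilbert `A`-module `E`. -/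
def adjointable : Subalgebra ℂ (E →L[ℂ] E) where
  carrier := {S | ∃ S' : E →L[ℂ] E, ∀ ξ η, inner A (S ξ) η = inner A ξ (S' η)}
  mul_mem' := by
    rintro S R ⟨S', hS⟩ ⟨R', hR⟩
    exact ⟨R' * S', fun ξ η => by simp [hS, hR]⟩
  add_mem' := by
    rintro S R ⟨S', hS⟩ ⟨R', hR⟩
    exact ⟨S' + R', fun ξ η => by simp [hS, hR]⟩
  algebraMap_mem' c := ⟨star c • 1, fun ξ η => by simp [Algebra.algebraMap_eq_smul_one]⟩

variable {A E}

variable (A) in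
theorem ext_inner {x y : E} (h : ∀ z : E, inner A z x = inner A z y) : x = y := by
  rw [← sub_eq_zero, ← CStarModule.inner_self (A := A), CStarModule.inner_sub_right, h, sub_self]

/-- The adjoint of an adjointable operator. -/
instance : Star (adjointable A E) where
  star S := ⟨S.2.choose, S, fun ξ η => by
    rw [← CStarModule.star_inner, ← S.2.choose_spec, CStarModule.star_inner]⟩

theorem inner_apply_left (S : adjointable A E) (ξ η : E) :
    inner A (S.1 ξ) η = inner A ξ ((star S).1 η) := S.2.choose_spec ξ η

theorem inner_apply_right (S : adjointable A E) (ξ η : E) :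
    inner A ξ (S.1 η) = inner A ((star S).1 ξ) η := by
  rw [← CStarModule.star_inner, inner_apply_left, CStarModule.star_inner]

theorem adjointable_ext {S R : adjointable A E}
    (h : ∀ ξ η, inner A ξ (S.1 η) = inner A ξ (R.1 η)) : S = R :=
  Subtype.ext (ContinuousLinearMap.ext fun η => ext_inner A fun ξ => h ξ η)

instance : StarRing (adjointable A E) where
  star_involutive S := adjointable_ext fun ξ η => by
    rw [inner_apply_right S, ← inner_apply_left (star S)]
  star_mul S R := adjointable_ext fun ξ η => by
    rw [← inner_apply_left]
    change inner A (S.1 (R.1 ξ)) η = inner A ξ ((star R).1 ((star S).1 η))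
    rw [inner_apply_left, inner_apply_left]
  star_add S R := adjointable_ext fun ξ η => by
    rw [← inner_apply_left]
    change inner A (S.1 ξ + R.1 ξ) η = inner A ξ ((star S).1 η + (star R).1 η)
    rw [CStarModule.inner_add_left, CStarModule.inner_add_right, inner_apply_left, inner_apply_left]

instance : StarModule ℂ (adjointable A E) where
  star_smul c S := adjointable_ext fun ξ η => by
    rw [← inner_apply_left]
    change inner A (c • S.1 ξ) η = inner A ξ (star c • (star S).1 η)
    rw [CStarModule.inner_smul_left_complex, CStarModule.inner_smul_right_complex,
      inner_apply_left]

instance : CStarRing (adjointable A E) where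
  norm_mul_self_le S := by
    have key : ‖S.1‖ ≤ Real.sqrt ‖(star S * S).1‖ := by
      refine ContinuousLinearMap.opNorm_le_bound _ (Real.sqrt_nonneg _) fun ξ => ?_
      rw [CStarModule.norm_eq_sqrt_norm_inner_self (A := A) (S.1 ξ), inner_apply_left]
      refine Real.sqrt_le_iff.mpr ⟨by positivity, ?_⟩
      rw [mul_pow, Real.sq_sqrt (norm_nonneg _)]
      calc ‖inner A ξ ((star S).1 (S.1 ξ))‖ ≤ ‖ξ‖ * ‖(star S * S).1 ξ‖ :=
            CStarModule.norm_inner_le E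
        _ ≤ ‖ξ‖ * (‖(star S * S).1‖ * ‖ξ‖) := by
            gcongr
            exact ContinuousLinearMap.le_opNorm _ _
        _ = ‖(star S * S).1‖ * ‖ξ‖ ^ 2 := by ring
    have h2 := mul_self_le_mul_self (norm_nonneg _) key
    rw [Real.mul_self_sqrt (norm_nonneg _)] at h2
    exact h2

theorem norm_star_adjointable (S : adjointable A E) : ‖star S‖ = ‖S‖ := norm_star S

instance : ContinuousStar (adjointable A E) where
  continuous_star := (starₗᵢ ℂ (E := adjointable A E)).continuous

instance [CompleteSpace E] : CompleteSpace (adjointable A E) := by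
  refine (isClosed_of_closure_subset
    (s := (adjointable A E : Set (E →L[ℂ] E))) fun S hS => ?_).completeSpace_coe
  obtain ⟨u, hu, hlim⟩ := mem_closure_iff_seq_limit.mp hS
  let R : ℕ → adjointable A E := fun n => ⟨u n, hu n⟩
  have hR : CauchySeq fun n => (star (R n)).1 := by
    have h := hlim.cauchySeq
    rw [Metric.cauchySeq_iff] at h ⊢
    intro ε hε
    obtain ⟨N, hN⟩ := h ε hε
    refine ⟨N, fun m hm n hn => ?_⟩
    have := hN m hm n hn
    rw [dist_eq_norm] at this ⊢
    calc ‖(star (R m)).1 - (star (R n)).1‖ = ‖star (R m - R n)‖ := by rw [star_sub]; rfl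
      _ = ‖R m - R n‖ := norm_star_adjointable _
      _ < ε := this
  obtain ⟨S', hS'⟩ := cauchySeq_tendsto_of_complete hR
  refine ⟨S', fun ξ η => ?_⟩
  have h1 : Filter.Tendsto (fun n => inner A (u n ξ) η) Filter.atTop (nhds (inner A (S ξ) η)) :=
    ((CStarModule.continuous_inner (A := A) (E := E)).comp
      (continuous_id.prodMk continuous_const)).continuousAt.tendsto.comp
        ((ContinuousLinearMap.apply ℂ E ξ).continuous.continuousAt.tendsto.comp hlim)
  have h2 : Filter.Tendsto (fun n => inner A ξ ((star (R n)).1 η)) Filter.atTop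
      (nhds (inner A ξ (S' η))) :=
    ((CStarModule.continuous_inner (A := A) (E := E)).comp
      (continuous_const.prodMk continuous_id)).continuousAt.tendsto.comp
        ((ContinuousLinearMap.apply ℂ E η).continuous.continuousAt.tendsto.comp hS')
  exact tendsto_nhds_unique h1 (h2.congr fun n => (inner_apply_left (R n) ξ η).symm)

/-- The adjointable operators on a Hilbert module form a C⋆-algebra. -/
instance [CompleteSpace E] : CStarAlgebra (adjointable A E) where

variable (A) in
/-- The operator `|ξ⟩⟨η| : ζ ↦ ξ⟨η | ζ⟩`. -/
def rankOneCLM (ξ η : E) : E →L[ℂ] E :=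
  LinearMap.mkContinuous
    { toFun := fun ζ => inner A η ζ • ξ
      map_add' := fun ζ θ => ext_inner A fun z => by simp [add_mul]
      map_smul' := fun c ζ => ext_inner A fun z => by simp [smul_mul_assoc] }
    (‖ξ‖ * ‖η‖) fun ζ => by
      change ‖inner A η ζ • ξ‖ ≤ _
      rw [CStarModule.norm_eq_sqrt_norm_inner_self (A := A) (inner A η ζ • ξ)]
      refine Real.sqrt_le_iff.mpr ⟨by positivity, ?_⟩
      rw [CStarModule.inner_op_smul_right, CStarModule.inner_op_smul_left]
      calc ‖inner A η ζ * (inner A ξ ξ * star (inner A η ζ))‖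
          ≤ ‖inner A η ζ‖ * (‖inner A ξ ξ‖ * ‖star (inner A η ζ)‖) :=
            (norm_mul_le _ _).trans (by gcongr; exact norm_mul_le _ _)
        _ ≤ (‖η‖ * ‖ζ‖) * ((‖ξ‖ * ‖ξ‖) * (‖η‖ * ‖ζ‖)) := by
            rw [norm_star]
            gcongr <;> exact CStarModule.norm_inner_le E
        _ = (‖ξ‖ * ‖η‖ * ‖ζ‖) ^ 2 := by ring

theorem rankOneCLM_apply (ξ η ζ : E) : rankOneCLM A ξ η ζ = inner A η ζ • ξ := rfl

theorem rankOne_adj (ξ η ζ θ : E) :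
    inner A (rankOneCLM A ξ η ζ) θ = inner A ζ (rankOneCLM A η ξ θ) := by
  simp [rankOneCLM_apply]

variable (A) in
/-- The operator `|ξ⟩⟨η|` as an adjointable operator. -/
def rankOne (ξ η : E) : adjointable A E := ⟨rankOneCLM A ξ η, rankOneCLM A η ξ, rankOne_adj ξ η⟩

theorem rankOne_apply (ξ η ζ : E) : (rankOne A ξ η).1 ζ = inner A η ζ • ξ := rfl

theorem star_rankOne (ξ η : E) : star (rankOne A ξ η) = rankOne A η ξ :=
  adjointable_ext fun ζ θ => by rw [← inner_apply_left]; exact rankOne_adj ξ η ζ θ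

theorem mul_rankOne (S : adjointable A E) (ξ η : E) :
    S * rankOne A ξ η = rankOne A (S.1 ξ) η :=
  adjointable_ext fun ζ θ => by
    change inner A ζ (S.1 (inner A η θ • ξ)) = inner A ζ (inner A η θ • S.1 ξ)
    rw [inner_apply_right]
    simp [inner_apply_right S ζ ξ]

variable (A E) in
/-- The span of the operators `|ξ⟩⟨η|`. -/
def finiteRank : NonUnitalStarSubalgebra ℂ (adjointable A E) where
  __ := Submodule.span ℂ {k | ∃ ξ η : E, k = rankOne A ξ η}
  mul_mem' := by
    intro k l _ hl
    induction hl using Submodule.span_induction with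
    | mem l h =>
      obtain ⟨ξ, η, rfl⟩ := h
      rw [mul_rankOne]
      exact Submodule.subset_span ⟨_, _, rfl⟩
    | zero => rw [mul_zero]; exact Submodule.zero_mem _
    | add l m _ _ h1 h2 => rw [mul_add]; exact Submodule.add_mem _ h1 h2
    | smul c l _ h => rw [mul_smul_comm]; exact Submodule.smul_mem _ c h
  star_mem' := by
    intro k hk
    induction hk using Submodule.span_induction with
    | mem l h =>
      obtain ⟨ξ, η, rfl⟩ := h
      rw [star_rankOne]
      exact Submodule.subset_span ⟨_, _, rfl⟩
    | zero => rw [star_zero]; exact Submodule.zero_mem _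
    | add l m _ _ h1 h2 => rw [star_add]; exact Submodule.add_mem _ h1 h2
    | smul c l _ h => rw [star_smul]; exact Submodule.smul_mem _ _ h

variable (A E) in
/-- The algebra `K_A(E)` of compact operators: the norm closure of the span of the `|ξ⟩⟨η|`. -/
def compacts : NonUnitalStarSubalgebra ℂ (adjointable A E) := (finiteRank A E).topologicalClosure

end Operators

/-! ### Morita equivalences -/

/-- An `A`-`B` imprimitivity bimodule (Morita equivalence) structure on `E`: commuting left and right
actions of the C⋆-algebras `A` and `B`, and full positive definite inner products
`linner = _A⟨ , ⟩` (linear in the first variable) and `rinner = ⟨ , ⟩_B` (linear in the second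
variable) with `_A⟨ξ, η⟩ ζ = ξ ⟨η, ζ⟩_B`, such that `E` is complete. -/
structure MoritaEquivalence (A B E : Type*) [NonUnitalCStarAlgebra A] [NonUnitalCStarAlgebra B]
    [AddCommGroup E] [Module ℂ E] where
  lact : A →ₗ[ℂ] E →ₗ[ℂ] E
  ract : E →ₗ[ℂ] B →ₗ[ℂ] E
  linner : E → E → A
  rinner : E → E → B
  lact_mul : ∀ a a' ξ, lact (a * a') ξ = lact a (lact a' ξ)
  ract_mul : ∀ ξ b b', ract ξ (b * b') = ract (ract ξ b) b'
  lact_ract : ∀ a ξ b, ract (lact a ξ) b = lact a (ract ξ b)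
  linner_add : ∀ ξ ξ' η, linner (ξ + ξ') η = linner ξ η + linner ξ' η
  linner_smul : ∀ (c : ℂ) ξ η, linner (c • ξ) η = c • linner ξ η
  linner_lact : ∀ a ξ η, linner (lact a ξ) η = a * linner ξ η
  linner_star : ∀ ξ η, star (linner ξ η) = linner η ξ
  linner_pos : ∀ ξ, ∃ a, linner ξ ξ = star a * a
  linner_definite : ∀ ξ, linner ξ ξ = 0 → ξ = 0
  rinner_add : ∀ ξ η η', rinner ξ (η + η') = rinner ξ η + rinner ξ η'
  rinner_smul : ∀ (c : ℂ) ξ η, rinner ξ (c • η) = c • rinner ξ η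
  rinner_ract : ∀ ξ η b, rinner ξ (ract η b) = rinner ξ η * b
  rinner_star : ∀ ξ η, star (rinner ξ η) = rinner η ξ
  rinner_pos : ∀ ξ, ∃ b, rinner ξ ξ = star b * b
  rinner_definite : ∀ ξ, rinner ξ ξ = 0 → ξ = 0
  linner_ract : ∀ ξ η b, linner (ract ξ b) η = linner ξ (ract η (star b))
  rinner_lact : ∀ a ξ η, rinner (lact a ξ) η = rinner ξ (lact (star a) η)
  imprimitivity : ∀ ξ η ζ, lact (linner ξ η) ζ = ract ξ (rinner η ζ)
  linner_full : closure (Submodule.span ℂ {a | ∃ ξ η, a = linner ξ η} : Set A) = Set.univ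
  rinner_full : closure (Submodule.span ℂ {b | ∃ ξ η, b = rinner ξ η} : Set B) = Set.univ
  /-- Completeness of `E` in the norm `‖ξ‖ = ‖⟨ξ, ξ⟩_B‖^{1/2}`, which is equal to the norm
  `‖_A⟨ξ, ξ⟩‖^{1/2}` by the other axioms. -/
  complete : ∀ u : ℕ → E,
    (∀ ε > 0, ∃ N, ∀ m ≥ N, ∀ n ≥ N, √‖rinner (u m - u n) (u m - u n)‖ < ε) →
    ∃ ξ, Filter.Tendsto (fun n => √‖rinner (u n - ξ) (u n - ξ)‖) Filter.atTop (nhds 0)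

/-! ### The fibres of a Hilbert `C₀(X)`-module -/

section Fibre

variable {X : Type*} [TopologicalSpace X] (E : Type*) [NormedAddCommGroup E] [NormedSpace ℂ E]
  [SMul C₀(X, ℂ) E] [CStarModule C₀(X, ℂ) E]

/-- The space `E` with the positive semidefinite inner product `⟨ξ | η⟩(x)`. -/
def PreFibre (_x : X) : Type _ := E

variable (x : X)

instance : AddCommGroup (PreFibre E x) := inferInstanceAs (AddCommGroup E)

instance : Module ℂ (PreFibre E x) := inferInstanceAs (Module ℂ E)

theorem inner_self_apply_nonneg {E : Type*} [NormedAddCommGroup E] [NormedSpace ℂ E]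
    [SMul C₀(X, ℂ) E] [CStarModule C₀(X, ℂ) E] (ξ : E) (x : X) :
    0 ≤ RCLike.re (inner C₀(X, ℂ) ξ ξ x) := by
  obtain ⟨b, hb⟩ := CStarAlgebra.nonneg_iff_eq_star_mul_self.mp
    (CStarModule.inner_self_nonneg (A := C₀(X, ℂ)) (x := ξ))
  rw [hb]
  simp only [ZeroAtInftyContinuousMap.mul_apply, ZeroAtInftyContinuousMap.star_apply,
    RCLike.star_def]
  rw [RCLike.conj_mul]
  norm_cast
  positivity

theorem conj_inner_apply {E : Type*} [NormedAddCommGroup E] [NormedSpace ℂ E]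
    [SMul C₀(X, ℂ) E] [CStarModule C₀(X, ℂ) E] (ξ η : E) (x : X) :
    starRingEnd ℂ (inner C₀(X, ℂ) η ξ x) = inner C₀(X, ℂ) ξ η x := by
  rw [← CStarModule.star_inner η ξ]
  rfl

/-- The semi-inner product `⟨ξ | η⟩(x)`. -/
@[reducible] def fibreCore : PreInnerProductSpace.Core ℂ (PreFibre E x) where
  inner ξ η := inner C₀(X, ℂ) (show E from ξ) (show E from η) x
  conj_inner_symm ξ η := conj_inner_apply (E := E) ξ η x
  re_inner_nonneg ξ := inner_self_apply_nonneg (E := E) ξ x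
  add_left ξ η ζ := by
    change inner C₀(X, ℂ) ((show E from ξ) + (show E from η)) (show E from ζ) x = _
    rw [CStarModule.inner_add_left]
    rfl
  smul_left ξ η c := by
    change inner C₀(X, ℂ) (c • (show E from ξ)) (show E from η) x = _
    rw [CStarModule.inner_smul_left_complex]
    rfl

instance : SeminormedAddCommGroup (PreFibre E x) :=
  @InnerProductSpace.Core.toSeminormedAddCommGroup ℂ _ _ _ _ (fibreCore E x)

instance : InnerProductSpace ℂ (PreFibre E x) := InnerProductSpace.ofCore (fibreCore E x)

/-- The Hilbert space `E_x = E ⊗_{C₀(X)} ℂ_x`. As `ξ ⊗ z = (zξ) ⊗ 1`, it is the Hausdorff completion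
of `E` for the inner product `⟨ξ ⊗ 1 | η ⊗ 1⟩ = ⟨ξ | η⟩(x)`. -/
abbrev Fibre : Type _ := UniformSpace.Completion (PreFibre E x)

end Fibre

/-! ### Twisted equivariant Hilbert modules -/

/-- An `(α, γ)`-twisted action of `W` on the Hilbert `C₀(X)`-module `E`. As `C₀(X)` is commutative,
the product `ξb` is written `b • ξ`. The condition `U_v U_w ξ = U_{vw}(ξ) γ(v,w)^*`, where
`γ(v,w)^*` is a multiplier, is expressed by multiplying both sides by an arbitrary `b` in
`C₀(X)`. -/
structure TwistedModuleAction {W X : Type*} [Group W] [TopologicalSpace X] [MulAction W X]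
    [ContinuousConstSMul W X] (T : TwistedAction W X) (E : Type*) [NormedAddCommGroup E]
    [NormedSpace ℂ E] [SMul C₀(X, ℂ) E] [CStarModule C₀(X, ℂ) E] where
  U : W → E ≃L[ℂ] E
  U_smul : ∀ (w : W) (b : C₀(X, ℂ)) (ξ : E), U w (b • ξ) = alpha w b • U w ξ
  inner_U : ∀ (w : W) (ξ η : E),
    inner C₀(X, ℂ) (U w ξ) (U w η) = alpha w (inner C₀(X, ℂ) ξ η)
  U_U : ∀ (v w : W) (ξ : E) (b : C₀(X, ℂ)),
    b • U v (U w ξ) = twist (T.γ v w)⁻¹ b • U (v * w) ξ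

namespace TwistedModuleAction

variable {W X : Type*} [Group W] [TopologicalSpace X] [MulAction W X]
  [ContinuousConstSMul W X] {T : TwistedAction W X} {E : Type*} [NormedAddCommGroup E]
  [NormedSpace ℂ E] [SMul C₀(X, ℂ) E] [CStarModule C₀(X, ℂ) E] (𝓤 : TwistedModuleAction T E)

theorem inner_U_U (v w : W) (ζ ξ : E) (x : X) :
    (T.γ v w x : ℂ) * inner C₀(X, ℂ) ζ (𝓤.U v (𝓤.U w ξ)) x =
      inner C₀(X, ℂ) ζ (𝓤.U (v * w) ξ) x := by
  have key : ∀ b : C₀(X, ℂ), b x * inner C₀(X, ℂ) ζ (𝓤.U v (𝓤.U w ξ)) x =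
      ((T.γ v w x : ℂ))⁻¹ * b x * inner C₀(X, ℂ) ζ (𝓤.U (v * w) ξ) x := by
    intro b
    have h := congrArg (fun η => inner C₀(X, ℂ) ζ η x) (𝓤.U_U v w ξ b)
    simpa using h
  have h0 : (T.γ v w x : ℂ) ≠ 0 := Circle.coe_ne_zero _
  by_cases h1 : inner C₀(X, ℂ) ζ (𝓤.U v (𝓤.U w ξ)) x = 0
  · have h := key (inner C₀(X, ℂ) ζ (𝓤.U (v * w) ξ))
    rw [h1] at h ⊢
    simpa [h0, eq_comm (a := (0 : ℂ))] using h
  · have h := key (inner C₀(X, ℂ) ζ (𝓤.U v (𝓤.U w ξ)))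
    field_simp at h
    linear_combination h

theorem U_one (ξ : E) : 𝓤.U 1 ξ = ξ := by
  apply (𝓤.U 1).injective
  refine ext_inner C₀(X, ℂ) fun ζ => ZeroAtInftyContinuousMap.ext fun x => ?_
  simpa [T.one_left] using 𝓤.inner_U_U 1 1 ζ ξ x

section Fixed

variable [CompleteSpace E]

/-- The fixed-point algebra `K_{C₀(X)}(E)^W` for the action `w : k ↦ U_w k U_w⁻¹`. -/
def fixedCompacts : NonUnitalStarSubalgebra ℂ (adjointable C₀(X, ℂ) E) where
  carrier := {k | k ∈ compacts C₀(X, ℂ) E ∧ ∀ (w : W) (ξ : E), 𝓤.U w (k.1 ξ) = k.1 (𝓤.U w ξ)}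
  add_mem' := by
    rintro k l ⟨hk, hk'⟩ ⟨hl, hl'⟩
    refine ⟨add_mem hk hl, fun w ξ => ?_⟩
    change 𝓤.U w (k.1 ξ + l.1 ξ) = k.1 (𝓤.U w ξ) + l.1 (𝓤.U w ξ)
    rw [map_add, hk', hl']
  zero_mem' := ⟨zero_mem _, fun w ξ => map_zero (𝓤.U w)⟩
  mul_mem' := by
    rintro k l ⟨hk, hk'⟩ ⟨hl, hl'⟩
    refine ⟨mul_mem hk hl, fun w ξ => ?_⟩
    change 𝓤.U w (k.1 (l.1 ξ)) = k.1 (l.1 (𝓤.U w ξ))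
    rw [hk', hl']
  smul_mem' := by
    rintro c k ⟨hk, hk'⟩
    refine ⟨SMulMemClass.smul_mem c hk, fun w ξ => ?_⟩
    change 𝓤.U w (c • k.1 ξ) = c • k.1 (𝓤.U w ξ)
    rw [ContinuousLinearEquiv.map_smul, hk']
  star_mem' := by
    rintro k ⟨hk, hk'⟩
    refine ⟨star_mem hk, fun w ξ => ext_inner C₀(X, ℂ) fun ζ => ?_⟩
    obtain ⟨ζ, rfl⟩ := (𝓤.U w).surjective ζ
    rw [𝓤.inner_U, ← inner_apply_left, ← 𝓤.inner_U, hk', inner_apply_left]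

theorem isClosed_fixedCompacts :
    IsClosed (𝓤.fixedCompacts : Set (adjointable C₀(X, ℂ) E)) := by
  have h : (𝓤.fixedCompacts : Set (adjointable C₀(X, ℂ) E)) =
      (compacts C₀(X, ℂ) E : Set (adjointable C₀(X, ℂ) E)) ∩
        ⋂ (w : W) (ξ : E), {k | 𝓤.U w (k.1 ξ) = k.1 (𝓤.U w ξ)} := by
    ext k
    simp only [Set.mem_inter_iff, Set.mem_iInter]
    rfl
  rw [h]
  refine (NonUnitalStarSubalgebra.isClosed_topologicalClosure _).inter
    (isClosed_iInter fun w => isClosed_iInter fun ξ => isClosed_eq ?_ ?_)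
  · exact (𝓤.U w).continuous.comp
      ((ContinuousLinearMap.apply ℂ E ξ).continuous.comp continuous_subtype_val)
  · exact (ContinuousLinearMap.apply ℂ E (𝓤.U w ξ)).continuous.comp continuous_subtype_val

instance : NonUnitalCStarAlgebra 𝓤.fixedCompacts :=
  NonUnitalStarSubalgebra.nonUnitalCStarAlgebra _ (h_closed := 𝓤.isClosed_fixedCompacts)

end Fixed

section CrossedProductModule

variable [Fintype W]

/-- The inner product `⟪ξ | η⟫ = ∑_w ⟨ξ | U_w η⟩ w` with values in `C₀(X) ⋊_γ W`. -/
def crossedInner (ξ η : E) : CrossedProduct T :=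
  CrossedProduct.mk fun w => inner C₀(X, ℂ) ξ (𝓤.U w η)

theorem star_crossedInner (ξ η : E) : star (𝓤.crossedInner ξ η) = 𝓤.crossedInner η ξ := by
  ext u x
  rw [CrossedProduct.star_coeff]
  change _ * starRingEnd ℂ (inner C₀(X, ℂ) ξ (𝓤.U u⁻¹ η) (u⁻¹ • x)) =
    inner C₀(X, ℂ) η (𝓤.U u ξ) x
  have h1 : inner C₀(X, ℂ) ξ (𝓤.U u⁻¹ η) (u⁻¹ • x) =
      inner C₀(X, ℂ) (𝓤.U u ξ) (𝓤.U u (𝓤.U u⁻¹ η)) x := by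
    rw [𝓤.inner_U, alpha_apply]
  rw [h1, ← map_mul, 𝓤.inner_U_U, mul_inv_cancel, 𝓤.U_one, conj_inner_apply]

/-- The right module structure `ξ · bw = U_w⁻¹(ξb)` of `E` over `C₀(X) ⋊_γ W`. -/
def crossedAct (ξ : E) (f : CrossedProduct T) : E :=
  ∑ w, (𝓤.U w).symm (f.coeff w • ξ)

theorem crossedInner_mul (ξ η : E) (f : CrossedProduct T) :
    𝓤.crossedInner ξ η * f = 𝓤.crossedInner ξ (𝓤.crossedAct η f) := by
  ext u x
  rw [CrossedProduct.mul_coeff]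
  change ∑ w, _ * (inner C₀(X, ℂ) ξ (𝓤.U w η) x * _) =
    inner C₀(X, ℂ) ξ (𝓤.U u (𝓤.crossedAct η f)) x
  rw [crossedAct, map_sum, CStarModule.inner_sum_right, CrossedProduct.sum_apply]
  refine Fintype.sum_equiv ((Equiv.inv W).trans (Equiv.mulRight u)) _ _ fun w => ?_
  simp only [Equiv.trans_apply, Equiv.inv_apply, Equiv.coe_mulRight]
  have h := 𝓤.inner_U_U w (w⁻¹ * u) ξ
    ((𝓤.U (w⁻¹ * u)).symm (f.coeff (w⁻¹ * u) • η)) x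
  rw [mul_inv_cancel_left] at h
  rw [← h, ContinuousLinearEquiv.apply_symm_apply, 𝓤.U_smul, CStarModule.inner_op_smul_right,
    ZeroAtInftyContinuousMap.mul_apply, alpha_apply]
  ring

/-- The span of the inner products `⟪ξ | η⟫`. -/
def innerSpan : NonUnitalStarSubalgebra ℂ (CrossedProduct T) where
  __ := Submodule.span ℂ {f | ∃ ξ η : E, f = 𝓤.crossedInner ξ η}
  mul_mem' := by
    intro k l hk _
    induction hk using Submodule.span_induction with
    | mem k h =>
      obtain ⟨ξ, η, rfl⟩ := h
      rw [crossedInner_mul]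
      exact Submodule.subset_span ⟨_, _, rfl⟩
    | zero => rw [zero_mul]; exact Submodule.zero_mem _
    | add k m _ _ h1 h2 => rw [add_mul]; exact Submodule.add_mem _ h1 h2
    | smul c k _ h => rw [smul_mul_assoc]; exact Submodule.smul_mem _ c h
  star_mem' := by
    intro k hk
    induction hk using Submodule.span_induction with
    | mem l h =>
      obtain ⟨ξ, η, rfl⟩ := h
      rw [star_crossedInner]
      exact Submodule.subset_span ⟨_, _, rfl⟩
    | zero => rw [star_zero]; exact Submodule.zero_mem _
    | add l m _ _ h1 h2 => rw [star_add]; exact Submodule.add_mem _ h1 h2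
    | smul c l _ h => rw [star_smul]; exact Submodule.smul_mem _ _ h

/-- `C(X, E, W)`: the closed span of the inner products `⟪ξ | η⟫` in `C₀(X) ⋊_γ W`. -/
def idealCXEW : NonUnitalStarSubalgebra ℂ (CrossedProduct T) := 𝓤.innerSpan.topologicalClosure

instance : NonUnitalCStarAlgebra 𝓤.idealCXEW :=
  NonUnitalStarSubalgebra.nonUnitalCStarAlgebra _
    (h_closed := NonUnitalStarSubalgebra.isClosed_topologicalClosure _)

end CrossedProductModule

/-! ### The operators `I_{w,x}`, the groups `W'_x` and the scalars `ι_{w,x}` -/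

section Intertwiners

variable {x y : X}

/-- The isometry `ξ ↦ U_w ξ` for the inner products at `x` and at `y = wx`. -/
def preIntertwiner (w : W) (h : w • x = y) : PreFibre E x →ₗᵢ[ℂ] PreFibre E y where
  __ := ((𝓤.U w).toLinearEquiv : E →ₗ[ℂ] E)
  norm_map' ξ := by
    change √(RCLike.re (inner C₀(X, ℂ) (𝓤.U w (show E from ξ)) (𝓤.U w (show E from ξ)) y)) =
      √(RCLike.re (inner C₀(X, ℂ) (show E from ξ) (show E from ξ) x))
    rw [𝓤.inner_U, alpha_apply, ← h, inv_smul_smul]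

/-- The operator `I_{w,x} : E_x → E_{wx}`, `ξ(x) ↦ (U_w ξ)(wx)`, where `y = wx`. -/
def intertwiner (w : W) (h : w • x = y) : Fibre E x →L[ℂ] Fibre E y :=
  (𝓤.preIntertwiner w h).toContinuousLinearMap.completion

/-- `w` fixes `x` and `I_{w,x}` is the scalar operator `c` on `E_x`. -/
def ActsByScalar (w : W) (x : X) (c : ℂ) : Prop :=
  ∃ h : w • x = x, ∀ v : Fibre E x, 𝓤.intertwiner w h v = c • v

/-- `W'_x`: the elements of the isotropy group `W_x` for which `I_{w,x}` is a scalar operator. -/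
def scalarGroup (x : X) : Set W := {w | ∃ c, 𝓤.ActsByScalar w x c}

open Classical in
/-- `ι_{w,x}`: the scalar with `I_{w,x} = ι_{w,x} id` for `w ∈ W'_x`. If `E_x = 0`, where this
scalar is not determined, it is taken to be `1`. -/
def iota (w : W) (x : X) : ℂ :=
  if h : ∃! c, 𝓤.ActsByScalar w x c then h.choose else 1

end Intertwiners

end TwistedModuleAction

/-! ### Projective representations and the completeness condition -/

/-- A unitary `η`-representation of `G`: `π(g) π(h) = η(g,h) π(gh)`. -/
def IsProjRep {G H : Type*} [Group G] [NormedAddCommGroup H] [InnerProductSpace ℂ H]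
    (η : G → G → Circle) (π : G → H ≃ₗᵢ[ℂ] H) : Prop :=
  ∀ (g h : G) (v : H), π g (π h v) = (η g h : ℂ) • π (g * h) v

/-- `H` is nonzero and has no proper nonzero invariant subspace. -/
def IsIrred {G H : Type*} [NormedAddCommGroup H] [InnerProductSpace ℂ H]
    (π : G → H ≃ₗᵢ[ℂ] H) : Prop :=
  Nontrivial H ∧ ∀ S : Submodule ℂ H, (∀ g, ∀ v ∈ S, π g v ∈ S) → S = ⊥ ∨ S = ⊤

namespace TwistedModuleAction

variable {W X : Type*} [Group W] [TopologicalSpace X] [MulAction W X]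
  [ContinuousConstSMul W X] {T : TwistedAction W X} {E : Type*} [NormedAddCommGroup E]
  [NormedSpace ℂ E] [SMul C₀(X, ℂ) E] [CStarModule C₀(X, ℂ) E] (𝓤 : TwistedModuleAction T E)

/-- `π` appears in the contragredient of `I_x : w ↦ I_{w,x}`: there is an isometric embedding of
`H_π` into the conjugate Hilbert space of `E_x`, that is, a conjugate-linear isometry
`S : H_π → E_x`, with `S (π(w) v) = I_{w,x} (S v)`. -/
def AppearsInContragredient (x : X) {H : Type*} [NormedAddCommGroup H] [InnerProductSpace ℂ H]
    (π : MulAction.stabilizer W x → H ≃ₗᵢ[ℂ] H) : Prop :=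
  ∃ S : H →ₗᵢ⋆[ℂ] Fibre E x, ∀ (w : MulAction.stabilizer W x) (v : H),
    S (π w v) = 𝓤.intertwiner w.1 w.2 (S v)

/-- The completeness condition: for every `x`, every irreducible unitary `γ_x`-representation of
`W_x` which lies over the conjugate of `ι_x` appears in the contragredient of `I_x`.
(Irreducible representations of finite groups are finite-dimensional, so every isomorphism class
is represented on a Hilbert space in the lowest universe.) -/
def CompletenessCondition : Prop :=
  ∀ (x : X) (H : Type) [NormedAddCommGroup H] [InnerProductSpace ℂ H] [CompleteSpace H]
    (π : MulAction.stabilizer W x → H ≃ₗᵢ[ℂ] H),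
    IsProjRep (fun v w : MulAction.stabilizer W x => T.γ v w x) π → IsIrred π →
    (∀ w : MulAction.stabilizer W x, w.1 ∈ 𝓤.scalarGroup x →
      ∀ v : H, π w v = starRingEnd ℂ (𝓤.iota w x) • v) →
    𝓤.AppearsInContragredient x π

end TwistedModuleAction

end TwistedMorita
end

noncomputable section

set_option linter.unusedSectionVars false

namespace TwistedMorita

/-! ### Positivity in C⋆-algebras -/

/-! The bimodule structure is formal. The identity `⟪ξ | η⟫ f = ⟪ξ | η · f⟫` makes the span of the
inner products a right ideal, and with `⟪ξ | η⟫^* = ⟪η | ξ⟫` its closure is a two-sided ideal. The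
imprimitivity identity forces the left inner product of `ξ` and `η` to be `ζ ↦ ξ · ⟪η | ζ⟫`, which
is the average over `W` of the rank-one operator `|ξ⟩⟨η|`; hence it is compact and `W`-invariant,
and averaging all finite-rank operators gives fullness. Positivity of both inner products follows
from one criterion: a self-adjoint `a` is positive if no `bab` with `b` self-adjoint is a nonzero
`-c^*c`. It applies because `bab` is again an inner product `⟪ξb | ξb⟫`, or the left inner product
of `bξ` with itself.

The completeness condition enters in the description of the ideal by coefficients. The relations on
the coefficients are necessary because `I_{w'w}` differs from `I_{w'} I_w` by a phase and `I_{w'}`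
is a scalar. For sufficiency, the span of the inner products is a `C₀(X)`-submodule of `C₀(X)^W`, so
a partition of unity reduces membership in its closure to pointwise values
(`mem_closure_of_forall_apply`).

At a point `x` the claim is linear duality (`mem_span_inner_apply`). A functional `φ` on `ℂ^W` which
kills all values of inner products satisfies `∑ φ(w) (U_w η)(x) = 0` for all `η`. Multiplying `η` by
functions that separate the orbit of `x` splits this relation over the cosets `W_x w₀`, giving
linear relations between the operators `I_{v,x}`, `v ∈ W_x`. By completeness their conjugates hold
in every irreducible `γ_x`-representation restricting to the conjugate of `ι_x` on `W'_x`, hence in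
the part of the twisted regular representation formed by the conjugates of functions with the
required covariance (`sum_mul_eq_zero_of_completeness`). Evaluation at the identity shows that `φ`
kills every such function. -/

theorem exists_eq_star_mul_self_of_conjugate {A : Type*} [NonUnitalCStarAlgebra A] {a : A}
    (ha : IsSelfAdjoint a)
    (h : ∀ b c : A, IsSelfAdjoint b → b * a * b = -(star c * c) → c = 0) :
    ∃ d, a = star d * d := by
  let _ : PartialOrder A := CStarAlgebra.spectralOrder A
  have _ : StarOrderedRing A := CStarAlgebra.spectralOrderedRing A
  have hn : 0 ≤ a⁻ := CFC.negPart_nonneg a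
  have hs : IsSelfAdjoint a⁻ := .of_nonneg hn
  have h3 : 0 ≤ a⁻ * a⁻ * a⁻ := by
    have := star_left_conjugate_nonneg hn a⁻
    rwa [hs.star_eq] at this
  obtain ⟨c, hc⟩ := CStarAlgebra.nonneg_iff_eq_star_mul_self.mp h3
  -- The test element is `b = a⁻`: since `a⁻ a⁺ = 0`, conjugation leaves only `-(a⁻)³`.
  have hb : a⁻ * a * a⁻ = -(star c * c) := by
    rw [← hc]
    have h1 : a⁻ * (a⁺ - a⁻) * a⁻ = -(a⁻ * a⁻ * a⁻) := by
      rw [mul_sub, sub_mul, CFC.negPart_mul_posPart, zero_mul, zero_sub]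
    rwa [CFC.posPart_sub_negPart a ha] at h1
  have h0 := h _ _ hs hb
  rw [h0, mul_zero] at hc
  have h4 : star (a⁻ * a⁻) * (a⁻ * a⁻) = 0 := by
    rw [star_mul, hs.star_eq, ← mul_assoc, hc, zero_mul]
  have h5 := CStarRing.star_mul_self_eq_zero_iff _ |>.mp h4
  rw [← hs.star_eq] at h5
  nth_rewrite 2 [hs.star_eq] at h5
  have h6 := CStarRing.star_mul_self_eq_zero_iff _ |>.mp h5
  exact CStarAlgebra.nonneg_iff_eq_star_mul_self.mp
    (CStarAlgebra.nonneg_iff_isSelfAdjoint_and_negPart_eq_zero.mpr ⟨ha, h6⟩)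

/-! ### Approximation in `C₀(X)`-modules of functions -/

section Approximation

variable {X : Type*} [TopologicalSpace X]

theorem norm_le_of_forall_apply {f : C₀(X, ℂ)} {C : ℝ} (hC : 0 ≤ C) (h : ∀ x, ‖f x‖ ≤ C) :
    ‖f‖ ≤ C := by
  rw [← ZeroAtInftyContinuousMap.norm_toBCF_eq_norm]
  exact (BoundedContinuousFunction.norm_le hC).mpr h

/-- A compactly supported real function as an element of `C₀(X)`. -/
def ofCompactSupport (f : C(X, ℝ)) (hf : HasCompactSupport f) : C₀(X, ℂ) where
  toFun x := (f x : ℂ)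
  continuous_toFun := by fun_prop
  zero_at_infty' :=
    (hf.comp_left (g := fun r : ℝ => (r : ℂ)) Complex.ofReal_zero).is_zero_at_infty

@[simp] theorem ofCompactSupport_apply (f : C(X, ℝ)) (hf : HasCompactSupport f) (x : X) :
    ofCompactSupport f hf x = (f x : ℂ) := rfl

variable [LocallyCompactSpace X] [T2Space X]

/-- A function in `C₀(X)` which separates a point from a finite set not containing it. -/
theorem exists_apply_eq_one_of_notMem_finite (x : X) {F : Set X} (hF : F.Finite) (hx : x ∉ F) :
    ∃ b : C₀(X, ℂ), b x = 1 ∧ ∀ y ∈ F, b y = 0 := by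
  obtain ⟨f, h1, h0, hc, -⟩ := exists_continuous_one_zero_of_isCompact (isCompact_singleton (x := x))
    hF.isClosed (Set.disjoint_singleton_left.mpr hx)
  refine ⟨ofCompactSupport f hc, ?_, fun y hy => ?_⟩
  · simp [h1 (Set.mem_singleton x)]
  · simp [h0 hy]

/-- A closed `C₀(X)`-submodule of `C₀(X)^ι` is determined by its values at the points of `X`. -/
theorem mem_closure_of_forall_apply {ι : Type*} [Fintype ι] (S : Submodule ℂ (ι → C₀(X, ℂ)))
    (hS : ∀ (b : C₀(X, ℂ)), ∀ g ∈ S, (fun i => b * g i) ∈ S) (f : ι → C₀(X, ℂ))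
    (h : ∀ x, ∃ g ∈ S, ∀ i, g i x = f i x) : f ∈ closure (S : Set (ι → C₀(X, ℂ))) := by
  rw [Metric.mem_closure_iff]
  intro ε hε
  choose g hgS hg using h
  -- Near `x` the element `g x` approximates `f` within `ε / 4`. A second `ε / 4` pays for the
  -- defect `1 - ∑ ρ` of the partition of unity outside `K`, where `f` itself is small.
  let V : X → Set X := fun x => {y | ∀ i, ‖f i y - g x i y‖ < ε / 4}
  have hV : ∀ x, IsOpen (V x) := fun x => by
    simp only [V, Set.ofPred_forall]
    exact isOpen_iInter_of_finite fun i => isOpen_lt (by fun_prop) continuous_const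
  have hxV : ∀ x, x ∈ V x := fun x i => by simpa [hg] using by positivity
  obtain ⟨K, hK, hKf⟩ : ∃ K : Set X, IsCompact K ∧ ∀ y ∉ K, ∀ i, ‖f i y‖ < ε / 4 := by
    have h1 : ∀ i, ∀ᶠ y in Filter.cocompact X, ‖f i y‖ < ε / 4 := fun i => by
      have := tendsto_zero_iff_norm_tendsto_zero.mp (zero_at_infty (f i))
      exact this.eventually (gt_mem_nhds (by positivity))
    have h2 := Filter.eventually_all.mpr h1
    obtain ⟨K, hK, hKs⟩ := Filter.mem_cocompact.mp h2
    exact ⟨K, hK, fun y hy => hKs hy⟩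
  obtain ⟨t, ht⟩ := hK.elim_finite_subcover V hV fun x _ => Set.mem_iUnion.mpr ⟨x, hxV x⟩
  obtain ⟨ρ, hρ, hρc⟩ := PartitionOfUnity.exists_isSubordinate_of_locallyFinite_t2space hK
    (fun i : t => V i) (fun i => hV i) (locallyFinite_of_finite _)
    (by simpa [Set.iUnion_subtype] using ht)
  refine ⟨∑ j : t, fun i => ofCompactSupport (ρ j) (hρc j) * g j i,
    Submodule.sum_mem _ fun j _ => hS _ _ (hgS j), ?_⟩
  rw [dist_pi_lt_iff hε]
  intro i
  rw [dist_eq_norm]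
  refine lt_of_le_of_lt (norm_le_of_forall_apply (C := ε / 2) (by positivity) fun y => ?_)
    (by linarith)
  rw [ZeroAtInftyContinuousMap.sub_apply, Finset.sum_apply, CrossedProduct.sum_apply]
  simp only [ZeroAtInftyContinuousMap.mul_apply, ofCompactSupport_apply]
  have hle : ∑ j, ρ j y ≤ 1 := by
    simpa [finsum_eq_sum_of_fintype] using ρ.sum_le_one y
  have hnn : ∀ j, 0 ≤ ρ j y := fun j => ρ.nonneg j y
  have hsplit : f i y - ∑ j : t, (ρ j y : ℂ) * g j i y =
      ((1 - ∑ j, ρ j y : ℝ) : ℂ) * f i y + ∑ j : t, (ρ j y : ℂ) * (f i y - g j i y) := by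
    simp only [mul_sub, Finset.sum_sub_distrib, ← Finset.sum_mul]
    push_cast
    ring
  rw [hsplit]
  have h1 : ‖((1 - ∑ j, ρ j y : ℝ) : ℂ) * f i y‖ ≤ ε / 4 := by
    rw [norm_mul, Complex.norm_real, Real.norm_eq_abs, abs_of_nonneg (by linarith)]
    by_cases hy : y ∈ K
    · have : ∑ j, ρ j y = 1 := by
        simpa [finsum_eq_sum_of_fintype] using ρ.sum_eq_one hy
      rw [this, sub_self, zero_mul]
      positivity
    · have h0 : 0 ≤ ∑ j, ρ j y := Finset.sum_nonneg fun j _ => hnn j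
      exact (mul_le_of_le_one_left (norm_nonneg _) (by linarith)).trans (hKf y hy i).le
  have h2 : ‖∑ j : t, (ρ j y : ℂ) * (f i y - g j i y)‖ ≤ ε / 4 := by
    calc ‖∑ j : t, (ρ j y : ℂ) * (f i y - g j i y)‖ ≤ ∑ j : t, ρ j y * (ε / 4) := by
          refine norm_sum_le_of_le _ fun j _ => ?_
          rw [norm_mul, Complex.norm_real, Real.norm_eq_abs, abs_of_nonneg (hnn j)]
          by_cases hy : ρ j y = 0
          · simp [hy]
          · exact mul_le_mul_of_nonneg_left (hρ j (subset_closure hy) i).le (hnn j)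
      _ = (∑ j, ρ j y) * (ε / 4) := by rw [Finset.sum_mul]
      _ ≤ ε / 4 := mul_le_of_le_one_left (by positivity) hle
  linarith [norm_add_le (((1 - ∑ j, ρ j y : ℝ) : ℂ) * f i y)
    (∑ j : t, (ρ j y : ℂ) * (f i y - g j i y))]

end Approximation

/-! ### The topology of the crossed product -/

namespace CrossedProduct

variable {W X : Type*} [Group W] [TopologicalSpace X] [MulAction W X] {T : TwistedAction W X}
  [ContinuousConstSMul W X] [Fintype W]

/-- Together with `norm_coeff_le`, this identifies the topology of the C⋆-norm with uniform
convergence of the coefficients, so that approximation can be carried out in `C₀(X)^W`. -/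
theorem continuous_mk : Continuous (mk : (W → C₀(X, ℂ)) → CrossedProduct T) := by
  refine isometry_toMatrix.isUniformInducing.isInducing.continuous_iff.mpr ?_
  refine CStarMatrix.uniformEmbedding_ofMatrix.uniformContinuous.continuous.comp ?_
  exact continuous_matrix fun u v =>
    (continuous_alpha _).comp ((continuous_twist _).comp (continuous_apply _))

theorem alpha_toMatrix (f : CrossedProduct T) (w : W) : alpha w (toMatrix f w 1) = f.coeff w := by
  ext x
  simp [toMatrix_apply, T.one_right]

theorem norm_alpha_le (w : W) (b : C₀(X, ℂ)) : ‖alpha w b‖ ≤ ‖b‖ :=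
  norm_le_of_forall_apply (norm_nonneg b) fun x => by
    rw [alpha_apply, ← ZeroAtInftyContinuousMap.norm_toBCF_eq_norm (f := b)]
    exact b.toBCF.norm_coe_le_norm _

theorem norm_coeff_le (f : CrossedProduct T) (w : W) : ‖f.coeff w‖ ≤ ‖f‖ := by
  rw [← alpha_toMatrix]
  exact (norm_alpha_le _ _).trans CStarMatrix.norm_entry_le_norm

theorem continuous_coeff (w : W) : Continuous fun f : CrossedProduct T => f.coeff w := by
  refine LipschitzWith.continuous (K := 1) (LipschitzWith.of_dist_le_mul fun f g => ?_)
  rw [NNReal.coe_one, one_mul, dist_eq_norm, dist_eq_norm, ← coeff_sub]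
  exact norm_coeff_le _ _

end CrossedProduct

theorem continuous_zeroAtInfty_apply {X : Type*} [TopologicalSpace X] (x : X) :
    Continuous fun b : C₀(X, ℂ) => b x := by
  refine LipschitzWith.continuous (K := 1) (LipschitzWith.of_dist_le_mul fun f g => ?_)
  rw [NNReal.coe_one, one_mul, ← ZeroAtInftyContinuousMap.dist_toBCF_eq_dist]
  exact BoundedContinuousFunction.dist_coe_le_dist (f := f.toBCF) (g := g.toBCF) x

/-! ### The twisted regular representation of a finite group -/

section Regular

variable {G : Type*} [Group G] [Fintype G]

/-- The operator `(R_g d)(v) = γ(v,g) d(vg)` on `ℓ²(G)`. -/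
def twistedRegular (γ : G → G → Circle) (g : G) :
    EuclideanSpace ℂ G ≃ₗᵢ[ℂ] EuclideanSpace ℂ G :=
  LinearIsometry.toLinearIsometryEquiv
    { toFun := fun d => WithLp.toLp 2 fun v => (γ v g : ℂ) * d (v * g)
      map_add' := fun d e => by ext v; simp [mul_add]
      map_smul' := fun c d => by ext v; simp [mul_left_comm]
      norm_map' := fun d => by
        rw [EuclideanSpace.norm_eq, EuclideanSpace.norm_eq]
        congr 1
        exact Fintype.sum_equiv (Equiv.mulRight g) _ _ fun v => by simp [Circle.norm_coe] } rfl

@[simp] theorem twistedRegular_apply (γ : G → G → Circle) (g : G) (d : EuclideanSpace ℂ G) (v : G) :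
    twistedRegular γ g d v = (γ v g : ℂ) * d (v * g) := rfl

theorem isProjRep_twistedRegular {γ : G → G → Circle}
    (hγ : ∀ u v w, γ v w * γ u (v * w) = γ (u * v) w * γ u v) :
    IsProjRep γ (twistedRegular γ) := by
  intro g h d
  ext v
  have h1 := congrArg (fun z : Circle => (z : ℂ)) (hγ v g h)
  simp only [Circle.coe_mul] at h1
  simp only [twistedRegular_apply, PiLp.smul_apply, smul_eq_mul, mul_assoc] at h1 ⊢
  linear_combination (-(d (v * (g * h)))) * h1

variable {K : Type*} [NormedAddCommGroup K] [InnerProductSpace ℂ K] [FiniteDimensional ℂ K]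

/-- The restriction of a unitary operator to a finite-dimensional invariant subspace. -/
def restrictInvariant (R : K ≃ₗᵢ[ℂ] K) (M : Submodule ℂ K) (hM : ∀ v ∈ M, R v ∈ M) : M ≃ₗᵢ[ℂ] M :=
  LinearIsometry.toLinearIsometryEquiv
    { toLinearMap := (R.toLinearEquiv : K →ₗ[ℂ] K).restrict hM
      norm_map' := fun v => R.norm_map v } rfl

@[simp] theorem coe_restrictInvariant (R : K ≃ₗᵢ[ℂ] K) (M : Submodule ℂ K)
    (hM : ∀ v ∈ M, R v ∈ M) (v : M) : (restrictInvariant R M hM v : K) = R v := rfl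

theorem mem_orthogonal_of_invariant (R : K ≃ₗᵢ[ℂ] K) (M : Submodule ℂ K) (hM : ∀ v ∈ M, R v ∈ M)
    {v : K} (hv : v ∈ Mᗮ) : R v ∈ Mᗮ := by
  rw [Submodule.mem_orthogonal] at hv ⊢
  intro u hu
  obtain ⟨u', hu'⟩ := (restrictInvariant R M hM).surjective ⟨u, hu⟩
  have h : u = R u' := congrArg Subtype.val hu'.symm
  rw [h, R.inner_map_map]
  exact hv _ u'.2

/-- If `∑_g a_g π(g)` vanishes for every irreducible unitary `γ`-representation `π` which restricts
to `χ` on `N`, then it vanishes for all finite-dimensional such representations. -/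
theorem sum_smul_eq_zero_of_irreducible {γ : G → G → Circle} (N : Set G) (χ a : G → ℂ)
    (H : ∀ (n : ℕ) (π : G → EuclideanSpace ℂ (Fin n) ≃ₗᵢ[ℂ] EuclideanSpace ℂ (Fin n)),
      IsProjRep γ π → IsIrred π → (∀ g ∈ N, ∀ v, π g v = χ g • v) → ∀ v, ∑ g, a g • π g v = 0)
    (R : G → K ≃ₗᵢ[ℂ] K) (hR : IsProjRep γ R) (M : Submodule ℂ K)
    (hM : ∀ g, ∀ v ∈ M, R g v ∈ M) (hN : ∀ g ∈ N, ∀ v ∈ M, R g v = χ g • v) :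
    ∀ v ∈ M, ∑ g, a g • R g v = 0 := by
  induction hn : Module.finrank ℂ M using Nat.strong_induction_on generalizing M with
  | _ n ih =>
  subst hn
  -- Maschke's argument: a proper invariant subspace `S` has the invariant complement `M ⊓ Sᗮ`, and
  -- both have smaller dimension. Otherwise `M` is zero or irreducible.
  by_cases hS : ∃ S ≤ M, (∀ g, ∀ v ∈ S, R g v ∈ S) ∧ S ≠ ⊥ ∧ S ≠ M
  · obtain ⟨S, hSM, hS, hS0, hS1⟩ := hS
    intro v hv
    obtain ⟨s, hs, z, hz, rfl⟩ := Submodule.exists_add_mem_mem_orthogonal (K := S) v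
    have hzM : z ∈ M := by simpa using M.sub_mem hv (hSM hs)
    have h1 := ih _ (Submodule.finrank_lt_finrank_of_lt (lt_of_le_of_ne hSM hS1)) S hS
      (fun g hg v hv => hN g hg v (hSM hv)) rfl s hs
    have h2 := ih (Module.finrank ℂ (M ⊓ Sᗮ : Submodule ℂ K))
      (Submodule.finrank_lt_finrank_of_lt (lt_of_le_of_ne inf_le_left fun h => hS0 ?_)) (M ⊓ Sᗮ)
      (fun g v hv => ⟨hM g v hv.1, mem_orthogonal_of_invariant (R g) S (hS g) hv.2⟩)
      (fun g hg v hv => hN g hg v hv.1) rfl z ⟨hzM, hz⟩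
    · simp only [map_add, smul_add, Finset.sum_add_distrib, h1, h2, add_zero]
    · have h3 : S ≤ Sᗮ := hSM.trans (inf_eq_left.mp h)
      exact Submodule.isOrtho_self.mp h3
  · push Not at hS
    rcases eq_or_ne M ⊥ with rfl | hM0
    · intro v hv
      simp [(Submodule.mem_bot ℂ).mp hv]
    intro v hv
    -- Coordinates move the irreducible representation to a standard space `ℂⁿ`, where the
    -- hypothesis `H` applies.
    let e := (stdOrthonormalBasis ℂ M).repr
    let π : G → EuclideanSpace ℂ (Fin (Module.finrank ℂ M)) ≃ₗᵢ[ℂ] _ := fun g =>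
      (e.symm.trans (restrictInvariant (R g) M (hM g))).trans e
    have hπ : ∀ g u, e.symm (π g u) = restrictInvariant (R g) M (hM g) (e.symm u) := fun g u => by
      simp [π]
    have h := H _ π ?_ ⟨?_, ?_⟩ ?_ (e ⟨v, hv⟩)
    · have h1 := congrArg (fun u => ((e.symm u : M) : K)) h
      simpa [map_sum, hπ] using h1
    · intro g h u
      apply e.symm.injective
      ext
      simp only [hπ, map_smul, coe_restrictInvariant, Submodule.coe_smul]
      exact hR g h _
    · have : Nontrivial M := Submodule.nontrivial_iff_ne_bot.mpr hM0
      exact e.symm.toEquiv.nontrivial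
    · intro S hSπ
      let j : EuclideanSpace ℂ (Fin (Module.finrank ℂ M)) →ₗ[ℂ] K :=
        M.subtype ∘ₗ (e.symm.toLinearEquiv : _ →ₗ[ℂ] M)
      have hj : Function.Injective j := M.subtype_injective.comp e.symm.injective
      have hjr : LinearMap.range j = M := by
        simp [j, LinearMap.range_comp]
      have hle : S.map j ≤ M := LinearMap.map_le_range.trans hjr.le
      have hinv : ∀ g, ∀ v ∈ S.map j, R g v ∈ S.map j := by
        rintro g _ ⟨u, hu, rfl⟩
        exact ⟨π g u, hSπ g u hu, congrArg Subtype.val (hπ g u)⟩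
      rcases eq_or_ne S ⊥ with h0 | h0
      · exact Or.inl h0
      · right
        have h1 := hS _ hle hinv fun h2 =>
          h0 (Submodule.map_injective_of_injective hj (h2.trans (Submodule.map_bot j).symm))
        apply Submodule.map_injective_of_injective hj
        rw [h1, Submodule.map_top, hjr]
    · intro g hg u
      apply e.symm.injective
      ext
      simp only [hπ, map_smul, coe_restrictInvariant, Submodule.coe_smul]
      exact hN g hg _ (e.symm u).2

end Regular

/-! ### Fibres and intertwiners -/

section FibreMap

variable {X : Type*} [TopologicalSpace X] {E : Type*} [NormedAddCommGroup E] [NormedSpace ℂ E]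
  [SMul C₀(X, ℂ) E] [CStarModule C₀(X, ℂ) E]

/-- The map `ξ ↦ ξ(x)` from `E` to the fibre `E_x`. -/
def fibreMap (x : X) (ξ : E) : Fibre E x := ((show PreFibre E x from ξ : PreFibre E x) : Fibre E x)

theorem inner_fibreMap (x : X) (ξ η : E) :
    inner ℂ (fibreMap x ξ) (fibreMap x η) = inner C₀(X, ℂ) ξ η x :=
  UniformSpace.Completion.inner_coe _ _

theorem denseRange_fibreMap (x : X) : DenseRange (fibreMap x : E → Fibre E x) :=
  UniformSpace.Completion.denseRange_coe (α := PreFibre E x)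

theorem clm_apply_eq_of_fibreMap {x : X} {F : Type*} [NormedAddCommGroup F] [NormedSpace ℂ F]
    {A B : Fibre E x →L[ℂ] F} (h : ∀ ξ : E, A (fibreMap x ξ) = B (fibreMap x ξ))
    (u : Fibre E x) : A u = B u :=
  congrFun ((denseRange_fibreMap (E := E) x).equalizer A.continuous B.continuous (funext h)) u

theorem fibre_ext {x : X} {u v : Fibre E x}
    (h : ∀ ξ : E, inner ℂ (fibreMap x ξ) u = inner ℂ (fibreMap x ξ) v) : u = v :=
  ext_inner_left ℂ fun z => (denseRange_fibreMap (E := E) x).induction_on z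
    (isClosed_eq (by fun_prop) (by fun_prop)) h

theorem fibreMap_smul (x : X) (b : C₀(X, ℂ)) (ξ : E) :
    fibreMap x (b • ξ) = b x • fibreMap x ξ :=
  fibre_ext fun ζ => by
    rw [inner_smul_right, inner_fibreMap, inner_fibreMap, CStarModule.inner_op_smul_right]
    rfl

end FibreMap

namespace TwistedModuleAction

variable {W X : Type*} [Group W] [TopologicalSpace X] [MulAction W X]
  [ContinuousConstSMul W X] {T : TwistedAction W X} {E : Type*} [NormedAddCommGroup E]
  [NormedSpace ℂ E] [SMul C₀(X, ℂ) E] [CStarModule C₀(X, ℂ) E] (𝓤 : TwistedModuleAction T E)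

theorem intertwiner_fibreMap {x y : X} (w : W) (h : w • x = y) (ξ : E) :
    𝓤.intertwiner w h (fibreMap x ξ) = fibreMap y (𝓤.U w ξ) :=
  UniformSpace.Completion.map_coe
    (𝓤.preIntertwiner w h).toContinuousLinearMap.uniformContinuous _

theorem smul_fibreMap_U_U (v w : W) (x : X) (ξ : E) :
    (T.γ v w x : ℂ) • fibreMap x (𝓤.U v (𝓤.U w ξ)) = fibreMap x (𝓤.U (v * w) ξ) :=
  fibre_ext fun ζ => by
    rw [inner_smul_right, inner_fibreMap, inner_fibreMap, 𝓤.inner_U_U]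

theorem intertwiner_comp {x y z : X} (v w : W) (hw : w • x = y) (hv : v • y = z)
    (hvw : (v * w) • x = z) (u : Fibre E x) :
    (T.γ v w z : ℂ) • 𝓤.intertwiner v hv (𝓤.intertwiner w hw u) = 𝓤.intertwiner (v * w) hvw u :=
  clm_apply_eq_of_fibreMap
    (A := (T.γ v w z : ℂ) • (𝓤.intertwiner v hv).comp (𝓤.intertwiner w hw))
    (fun ξ => by
      change (T.γ v w z : ℂ) • 𝓤.intertwiner v hv (𝓤.intertwiner w hw (fibreMap x ξ)) = _
      rw [intertwiner_fibreMap, intertwiner_fibreMap, intertwiner_fibreMap, smul_fibreMap_U_U]) u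

variable {𝓤}

/-- A scalar that is not unique can only occur on a zero fibre, where the default value `1` works as
well. -/
theorem actsByScalar_iota {w : W} {x : X} (hw : w ∈ 𝓤.scalarGroup x) :
    𝓤.ActsByScalar w x (𝓤.iota w x) := by
  unfold iota
  split_ifs with h
  · exact h.choose_spec.1
  · obtain ⟨c, hx, hc⟩ := hw
    refine ⟨hx, fun v => ?_⟩
    by_contra hv
    refine h ⟨c, ⟨hx, hc⟩, fun c' hc' => ?_⟩
    have h0 : v ≠ 0 := by rintro rfl; simp at hv
    have h1 := (hc v).symm.trans (hc'.2 v)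
    exact (smul_left_injective ℂ h0 h1).symm

theorem ActsByScalar.unique {w : W} {x : X} {c c' : ℂ} (h : 𝓤.ActsByScalar w x c)
    (h' : 𝓤.ActsByScalar w x c') {u : Fibre E x} (hu : u ≠ 0) : c = c' :=
  smul_left_injective ℂ hu ((h.2 u).symm.trans (h'.2 u))

/-- Up to phases, `I_{vnv⁻¹}` is the conjugate of the scalar `I_n` by `I_v`. Hence `W'_x` is normal
in `W_x`, and the phases say how `ι_x` changes under conjugation. -/
theorem ActsByScalar.conj {v n : W} {x : X} (hv : v • x = x) {c : ℂ} (h : 𝓤.ActsByScalar n x c) :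
    𝓤.ActsByScalar (v * n * v⁻¹) x
      ((T.γ (v * n * v⁻¹) v x : ℂ)⁻¹ * ((T.γ v n x : ℂ) * c)) := by
  obtain ⟨hn, hc⟩ := h
  have hm : (v * n * v⁻¹) • x = x := by
    rw [mul_smul, mul_smul, inv_smul_eq_iff.mpr hv.symm, hn, hv]
  have hmv : v * n * v⁻¹ * v = v * n := by group
  have hvn : (v * n) • x = x := by rw [mul_smul, hn, hv]
  refine ⟨hm, clm_apply_eq_of_fibreMap
    (B := ((T.γ (v * n * v⁻¹) v x : ℂ)⁻¹ * ((T.γ v n x : ℂ) * c)) • .id ℂ _) fun ξ => ?_⟩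
  -- It suffices to test on vectors `I_v u`, where `vnv⁻¹ · v = v · n` gives two factorisations of
  -- `I_{vn}` to compare.
  obtain ⟨ξ, rfl⟩ := (𝓤.U v).surjective ξ
  rw [← 𝓤.intertwiner_fibreMap v hv]
  generalize fibreMap x ξ = u
  change _ = ((T.γ (v * n * v⁻¹) v x : ℂ)⁻¹ * ((T.γ v n x : ℂ) * c)) • 𝓤.intertwiner v hv u
  have h1 := 𝓤.intertwiner_comp (v * n * v⁻¹) v hv hm (by rw [hmv, hvn]) u
  have h2 := 𝓤.intertwiner_comp v n hn hv hvn u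
  simp only [hmv] at h1
  rw [← h2, hc, map_smul] at h1
  rw [mul_smul, mul_smul, ← h1, smul_smul, inv_mul_cancel₀ (Circle.coe_ne_zero _), one_smul]

theorem iota_eq_one_of_subsingleton {x : X} (h : ∀ u : Fibre E x, u = 0) (w : W) :
    𝓤.iota w x = 1 := by
  unfold iota
  rw [dif_neg]
  rintro ⟨c, ⟨hx, -⟩, hc⟩
  have h0 := hc 0 ⟨hx, fun v => by rw [h (𝓤.intertwiner w hx v), zero_smul]⟩
  have h1 := hc 1 ⟨hx, fun v => by rw [h (𝓤.intertwiner w hx v), h v, smul_zero]⟩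
  exact zero_ne_one (h0.trans h1.symm)

theorem mem_scalarGroup_of_subsingleton {x : X} (h : ∀ u : Fibre E x, u = 0) {w : W}
    (hw : w • x = x) : w ∈ 𝓤.scalarGroup x :=
  ⟨1, hw, fun v => by rw [h (𝓤.intertwiner w hw v), h v, smul_zero]⟩

variable (𝓤)

theorem inner_U_mul {x : X} {w' : W} (hw' : w' ∈ 𝓤.scalarGroup x) (w : W) (ξ η : E) :
    inner C₀(X, ℂ) ξ (𝓤.U (w' * w) η) x =
      𝓤.iota w' x * T.γ w' w x * inner C₀(X, ℂ) ξ (𝓤.U w η) x := by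
  obtain ⟨hx, hs⟩ := actsByScalar_iota hw'
  rw [← inner_fibreMap, ← inner_fibreMap, ← smul_fibreMap_U_U, ← 𝓤.intertwiner_fibreMap w' hx, hs,
    inner_smul_right, inner_smul_right]
  ring

/-! ### Consequences of the completeness condition at a point -/

section Point

variable {x : X}

/-- The scalar cocycle `γ_x` satisfies the cocycle identity on the isotropy group. -/
theorem cocycle_apply_of_smul_eq (T : TwistedAction W X) {u : W} (hu : u • x = x) (v w : W) :
    T.γ v w x * T.γ u (v * w) x = T.γ (u * v) w x * T.γ u v x := by
  have h := T.cocycle u v w x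
  rwa [inv_smul_eq_iff.mpr hu.symm] at h

variable [Fintype (MulAction.stabilizer W x)]

/-- A linear relation between the operators `I_{v,x}` passes, after conjugation, to each irreducible
representation covered by the completeness condition, and so to the space `M` of functions on `W_x`
with the conjugate covariance, on which `W_x` acts by the twisted regular representation. This space
contains the conjugate of `d`. -/
theorem sum_mul_eq_zero_of_completeness (h𝓤 : 𝓤.CompletenessCondition)
    (ψ : MulAction.stabilizer W x → ℂ)
    (hψ : ∀ u : Fibre E x, ∑ v, ψ v • 𝓤.intertwiner v.1 v.2 u = 0)
    (d : MulAction.stabilizer W x → ℂ)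
    (hd : ∀ n v : MulAction.stabilizer W x, n.1 ∈ 𝓤.scalarGroup x →
      d (n * v) = 𝓤.iota n x * T.γ n v x * d v) :
    ∑ v, ψ v * d v = 0 := by
  let γ : MulAction.stabilizer W x → MulAction.stabilizer W x → Circle := fun v w => T.γ v w x
  have hγ : ∀ u v w, γ v w * γ u (v * w) = γ (u * v) w * γ u v := fun u v w =>
    cocycle_apply_of_smul_eq T u.2 v w
  let M : Submodule ℂ (EuclideanSpace ℂ (MulAction.stabilizer W x)) :=
    { carrier := {d | ∀ n v : MulAction.stabilizer W x, n.1 ∈ 𝓤.scalarGroup x →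
        d (n * v) = starRingEnd ℂ (𝓤.iota n x * T.γ n v x) * d v}
      add_mem' := fun {d e} hd he n v hn => by
        simp only [PiLp.add_apply, hd n v hn, he n v hn, mul_add]
      zero_mem' := fun n v _ => by simp
      smul_mem' := fun c d hd n v hn => by
        simp only [PiLp.smul_apply, hd n v hn, smul_eq_mul, mul_left_comm] }
  have hconj : ∀ z : Circle, starRingEnd ℂ (z : ℂ) * z = 1 := fun z => by
    rw [mul_comm, Complex.mul_conj, Circle.normSq_coe, Complex.ofReal_one]
  -- The covariance concerns left translations and the representation acts by right translations;
  -- the cocycle identity makes them compatible.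
  have hMR : ∀ g, ∀ e ∈ M, twistedRegular γ g e ∈ M := by
    intro g e he n v hn
    rw [twistedRegular_apply, twistedRegular_apply, mul_assoc, he n (v * g) hn]
    have h := congrArg (fun z : Circle => (z : ℂ)) (hγ n v g)
    simp only [Circle.coe_mul] at h
    simp only [map_mul]
    have h1 := hconj (γ n v)
    have h2 := hconj (γ n (v * g))
    have h3 : (γ (n * v) g : ℂ) * starRingEnd ℂ (γ n (v * g) : ℂ) =
        starRingEnd ℂ (γ n v : ℂ) * γ v g := by
      linear_combination (-(starRingEnd ℂ (γ n (v * g) : ℂ) * starRingEnd ℂ (γ n v : ℂ))) * h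
        - (starRingEnd ℂ (γ n (v * g) : ℂ) * γ (n * v) g) * h1
        + (starRingEnd ℂ (γ n v : ℂ) * γ v g) * h2
    linear_combination (starRingEnd ℂ (𝓤.iota n x) * e (v * g)) * h3
  -- Writing `vn = (vnv⁻¹)v` turns right translation by `n` into left translation by an element of
  -- `W'_x`, whose scalar is known from `ActsByScalar.conj`.
  have hMN : ∀ n ∈ {n : MulAction.stabilizer W x | n.1 ∈ 𝓤.scalarGroup x}, ∀ e ∈ M,
      twistedRegular γ n e = starRingEnd ℂ (𝓤.iota n x) • e := by
    intro n hn e he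
    ext v
    rw [twistedRegular_apply, PiLp.smul_apply, smul_eq_mul]
    by_cases h0 : ∀ u : Fibre E x, u = 0
    · have hall : ∀ w : MulAction.stabilizer W x, e w = e 1 := by
        intro w
        have h := he w 1 (mem_scalarGroup_of_subsingleton h0 w.2)
        simpa [iota_eq_one_of_subsingleton h0, T.one_right] using h
      have h := he v n (mem_scalarGroup_of_subsingleton h0 v.2)
      rw [iota_eq_one_of_subsingleton h0, one_mul] at h
      rw [h, iota_eq_one_of_subsingleton h0, map_one, one_mul, ← mul_assoc]
      have h1 := hconj (γ v n)
      rw [mul_comm (γ v n : ℂ), h1, one_mul, hall n, hall v]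
    · push Not at h0
      obtain ⟨u, hu⟩ := h0
      have hn' : (n : W) ∈ 𝓤.scalarGroup x := hn
      have hv : (v : W) • x = x := v.2
      have h1 := ActsByScalar.conj hv (actsByScalar_iota hn')
      have hm : ((v * n * v⁻¹ : MulAction.stabilizer W x) : W) ∈ 𝓤.scalarGroup x := ⟨_, h1⟩
      have h2 : 𝓤.iota (v * n * (v : W)⁻¹) x = _ := (actsByScalar_iota hm).unique h1 hu
      have h3 := he (v * n * v⁻¹) v hm
      rw [inv_mul_cancel_right] at h3
      have h4 : 𝓤.iota (v * n * (v : W)⁻¹) x * T.γ (v * n * (v : W)⁻¹) v x =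
          T.γ v n x * 𝓤.iota n x := by
        have hp : (T.γ (v * n * (v : W)⁻¹) v x : ℂ) ≠ 0 := Circle.coe_ne_zero _
        rw [h2, mul_comm, mul_inv_cancel_left₀ hp]
      have h6 : e (v * n) = starRingEnd ℂ
          (𝓤.iota (v * n * (v : W)⁻¹) x * T.γ (v * n * (v : W)⁻¹) v x) * e v := h3
      rw [h6, h4, map_mul]
      have h5 := hconj (γ v n)
      linear_combination (starRingEnd ℂ (𝓤.iota n x) * e v) * h5
  have key := sum_smul_eq_zero_of_irreducible (γ := γ) _ _
    (fun v => starRingEnd ℂ (ψ v)) ?_ (twistedRegular γ) (isProjRep_twistedRegular hγ) M hMR hMN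
    (WithLp.toLp 2 fun v => starRingEnd ℂ (d v)) ?_
  -- As `γ(1, g) = 1`, the value at the identity is the conjugate of `∑ ψ d`.
  · have h1 := congrArg (fun e : EuclideanSpace ℂ (MulAction.stabilizer W x) =>
      starRingEnd ℂ (e 1)) key
    simpa [γ, T.one_left] using h1
  · intro n π hπ hirr hN v
    -- The embedding `S` is conjugate-linear, so it carries the sum with coefficients conjugate to
    -- `ψ` to the vanishing sum `∑ ψ(w) I_w (S v)`.
    obtain ⟨S, hS⟩ := h𝓤 x _ π hπ hirr (fun w hw v => hN w hw v)
    apply S.injective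
    rw [map_sum, map_zero, ← hψ (S v)]
    refine Finset.sum_congr rfl fun w _ => ?_
    rw [map_smulₛₗ, hS, starRingEnd_self_apply]
  · intro n v hn
    simp [hd n v hn]

end Point

/-! ### From the isotropy group `W_x` to all of `W` -/

variable [LocallyCompactSpace X] [T2Space X] [Fintype W]

/-- Replace `η` by `bη`, where `b` is `1` at `w₀⁻¹x` and `0` at the other points of the orbit. The
term of `ww₀` acquires the factor `b((ww₀)⁻¹x)`, which is `1` for `w ∈ W_x` and `0` otherwise. -/
theorem sum_stabilizer_smul_fibreMap_eq_zero (x : X) [Fintype (MulAction.stabilizer W x)]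
    (φ : W → ℂ) (hφ : ∀ η : E, ∑ w, φ w • fibreMap x (𝓤.U w η) = 0) (w₀ : W) (η : E) :
    ∑ v : MulAction.stabilizer W x, φ (v * w₀) • fibreMap x (𝓤.U (v * w₀) η) = 0 := by
  classical
  obtain ⟨b, hb1, hb0⟩ := exists_apply_eq_one_of_notMem_finite (w₀⁻¹ • x)
    (F := {y | y ∈ Set.range (fun w : W => w⁻¹ • x) ∧ y ≠ w₀⁻¹ • x})
    ((Set.finite_range _).subset fun _ h => h.1) (fun h => h.2 rfl)
  have h1 := hφ (b • η)
  rw [← Fintype.sum_equiv (Equiv.mulRight w₀) (fun w => φ (w * w₀) •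
    fibreMap x (𝓤.U (w * w₀) (b • η))) _ fun _ => rfl] at h1
  have h2 := Finset.sum_subtype (p := fun w => w ∈ MulAction.stabilizer W x)
    (F := ‹Fintype (MulAction.stabilizer W x)›)
    (Finset.univ.filter fun w => w ∈ MulAction.stabilizer W x) (by simp)
    (fun w => φ (w * w₀) • fibreMap x (𝓤.U (w * w₀) η))
  refine h2.symm.trans ?_
  rw [← h1, Finset.sum_filter]
  refine Finset.sum_congr rfl fun w _ => ?_
  rw [𝓤.U_smul, fibreMap_smul, alpha_apply]
  split_ifs with hw
  · rw [mul_inv_rev, mul_smul, inv_smul_eq_iff.mpr (MulAction.mem_stabilizer_iff.mp hw).symm, hb1,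
      one_smul]
  · rw [hb0 _ ⟨⟨_, rfl⟩, fun h => hw ?_⟩, zero_smul, smul_zero]
    simp only [mul_inv_rev, mul_smul] at h
    exact MulAction.mem_stabilizer_iff.mpr
      (inv_smul_eq_iff.mp (MulAction.injective w₀⁻¹ h)).symm

theorem mem_span_inner_apply (h𝓤 : 𝓤.CompletenessCondition) (x : X) (c : W → ℂ)
    (hc : ∀ w' ∈ 𝓤.scalarGroup x, ∀ w, c (w' * w) = 𝓤.iota w' x * T.γ w' w x * c w) :
    c ∈ Submodule.span ℂ {c | ∃ ξ η : E, c = fun w => inner C₀(X, ℂ) ξ (𝓤.U w η) x} := by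
  classical
  by_contra hmem
  obtain ⟨f, hf, hker⟩ := Submodule.exists_le_ker_of_notMem hmem
  let φ : W → ℂ := fun w => f (Pi.single w 1)
  have hfφ : ∀ c, f c = ∑ w, φ w * c w := fun c => by
    conv_lhs => rw [← Finset.univ_sum_single c, map_sum]
    refine Finset.sum_congr rfl fun w _ => ?_
    rw [mul_comm, ← smul_eq_mul, ← map_smul, ← Pi.single_smul, smul_eq_mul, mul_one]
  have hφ : ∀ η : E, ∑ w, φ w • fibreMap x (𝓤.U w η) = 0 := fun η => fibre_ext fun ξ => by
    have h := hker (Submodule.subset_span ⟨ξ, η, rfl⟩)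
    rw [LinearMap.mem_ker, hfφ] at h
    simpa [inner_sum, inner_smul_right, inner_fibreMap] using h
  let _ : Fintype (MulAction.stabilizer W x) := Fintype.ofFinite _
  have hw₀ : ∀ w₀ : W, ∑ v : MulAction.stabilizer W x, φ (v * w₀) * c (v * w₀) = 0 := by
    intro w₀
    -- The operator `γ(v,w₀) I_v` takes `(U_{w₀} η)(x)` to `(U_{vw₀} η)(x)`, whence the phase in
    -- `ψ`. The inverse phase in `d` restores the product `φ c` and gives `d` its covariance under
    -- `W'_x`.
    have h := 𝓤.sum_mul_eq_zero_of_completeness h𝓤 (x := x)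
      (fun v => φ (v * w₀) * T.γ v w₀ x) (fun u => ?_)
      (fun v => (T.γ v w₀ x : ℂ)⁻¹ * c (v * w₀)) (fun n v hn => ?_)
    · rw [← h]
      refine Finset.sum_congr rfl fun v _ => ?_
      have h0 : (T.γ v w₀ x : ℂ) ≠ 0 := Circle.coe_ne_zero _
      field_simp
    · have hA := clm_apply_eq_of_fibreMap (A := ∑ v : MulAction.stabilizer W x,
        (φ (v * w₀) * T.γ v w₀ x : ℂ) • 𝓤.intertwiner v.1 v.2) (B := 0) (fun ξ => ?_) u
      · simpa [_root_.sum_apply] using hA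
      obtain ⟨η, rfl⟩ := (𝓤.U w₀).surjective ξ
      rw [_root_.zero_apply, _root_.sum_apply,
        ← 𝓤.sum_stabilizer_smul_fibreMap_eq_zero x φ hφ w₀ η]
      refine Finset.sum_congr rfl fun v _ => ?_
      rw [_root_.smul_apply, 𝓤.intertwiner_fibreMap v.1 v.2, mul_smul, smul_fibreMap_U_U]
    · have h1 := congrArg (fun z : Circle => (z : ℂ)) (cocycle_apply_of_smul_eq T n.2 v.1 w₀)
      simp only [Circle.coe_mul] at h1
      have h2 : (T.γ v w₀ x : ℂ) ≠ 0 := Circle.coe_ne_zero _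
      have h3 : (T.γ (n * v : MulAction.stabilizer W x) w₀ x : ℂ) ≠ 0 := Circle.coe_ne_zero _
      have h4 := hc n hn (v * w₀)
      rw [Subgroup.coe_mul] at h3 ⊢
      rw [mul_assoc (n : W), h4]
      field_simp
      linear_combination (𝓤.iota n x * c (v * w₀)) * h1
  apply hf
  rw [hfφ]
  -- Summing over all `w₀ ∈ W` instead of coset representatives counts every `w` exactly `|W_x|`
  -- times.
  have h1 : ∑ v : MulAction.stabilizer W x, ∑ w₀, φ (v * w₀) * c (v * w₀) = 0 := by
    rw [Finset.sum_comm]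
    exact Finset.sum_eq_zero fun w₀ _ => hw₀ w₀
  have h2 : ∀ v : MulAction.stabilizer W x,
      ∑ w₀, φ (v * w₀) * c (v * w₀) = ∑ w, φ w * c w := fun v =>
    Fintype.sum_equiv (Equiv.mulLeft (v : W)) _ _ fun _ => rfl
  rw [Finset.sum_congr rfl fun v _ => h2 v, Finset.sum_const, Finset.card_univ, smul_eq_zero] at h1
  exact h1.resolve_left Fintype.card_ne_zero

end TwistedModuleAction

namespace TwistedModuleAction

variable {W X : Type*} [Group W] [TopologicalSpace X] [MulAction W X]
  [ContinuousConstSMul W X] {T : TwistedAction W X} {E : Type*} [NormedAddCommGroup E]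
  [NormedSpace ℂ E] [SMul C₀(X, ℂ) E] [CStarModule C₀(X, ℂ) E] (𝓤 : TwistedModuleAction T E)
  [Fintype W]

/-! ### The ideal `C(X, E, W)` -/

theorem crossedInner_coeff (ξ η : E) (w : W) :
    (𝓤.crossedInner ξ η).coeff w = inner C₀(X, ℂ) ξ (𝓤.U w η) := rfl

theorem crossedInner_mem (ξ η : E) : 𝓤.crossedInner ξ η ∈ 𝓤.idealCXEW :=
  subset_closure (Submodule.subset_span ⟨ξ, η, rfl⟩)

theorem mul_mem_idealCXEW_right {f : CrossedProduct T} (hf : f ∈ 𝓤.idealCXEW)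
    (g : CrossedProduct T) : f * g ∈ 𝓤.idealCXEW := by
  refine map_mem_closure (f := fun f => f * g) (continuous_mul_const g) hf fun k hk => ?_
  change k ∈ Submodule.span ℂ _ at hk
  change k * g ∈ Submodule.span ℂ _
  induction hk using Submodule.span_induction with
  | mem k h =>
    obtain ⟨ξ, η, rfl⟩ := h
    rw [crossedInner_mul]
    exact Submodule.subset_span ⟨_, _, rfl⟩
  | zero => rw [zero_mul]; exact Submodule.zero_mem _
  | add k m _ _ h1 h2 => rw [add_mul]; exact Submodule.add_mem _ h1 h2
  | smul c k _ h => rw [smul_mul_assoc]; exact Submodule.smul_mem _ c h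

theorem mul_mem_idealCXEW_left {f : CrossedProduct T} (hf : f ∈ 𝓤.idealCXEW)
    (g : CrossedProduct T) : g * f ∈ 𝓤.idealCXEW := by
  have h := star_mem (𝓤.mul_mem_idealCXEW_right (star_mem hf) (star g))
  rwa [star_mul, star_star, star_star] at h

theorem coeff_mul_of_mem_idealCXEW {f : CrossedProduct T} (hf : f ∈ 𝓤.idealCXEW) {x : X} {w' : W}
    (hw' : w' ∈ 𝓤.scalarGroup x) (w : W) :
    f.coeff (w' * w) x = 𝓤.iota w' x * T.γ w' w x * f.coeff w x := by
  have hcont : ∀ w, Continuous fun f : CrossedProduct T => f.coeff w x := fun w =>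
    (continuous_zeroAtInfty_apply x).comp (CrossedProduct.continuous_coeff w)
  refine closure_minimal (fun k hk => ?_)
    (isClosed_eq (hcont (w' * w)) (continuous_const.mul (hcont w))) hf
  change k ∈ Submodule.span ℂ _ at hk
  change k.coeff (w' * w) x = 𝓤.iota w' x * T.γ w' w x * k.coeff w x
  induction hk using Submodule.span_induction with
  | mem k h =>
    obtain ⟨ξ, η, rfl⟩ := h
    exact 𝓤.inner_U_mul hw' w ξ η
  | zero => simp
  | add k m _ _ h1 h2 =>
    simp only [CrossedProduct.coeff_add, ZeroAtInftyContinuousMap.add_apply, h1, h2, mul_add]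
  | smul c k _ h =>
    simp only [CrossedProduct.coeff_smul, ZeroAtInftyContinuousMap.smul_apply, h, smul_eq_mul,
      mul_left_comm]

theorem exists_mem_innerSpan_coeff_apply (x : X) {c : W → ℂ}
    (hc : c ∈ Submodule.span ℂ {c | ∃ ξ η : E, c = fun w => inner C₀(X, ℂ) ξ (𝓤.U w η) x}) :
    ∃ g ∈ 𝓤.innerSpan, ∀ w, g.coeff w x = c w := by
  induction hc using Submodule.span_induction with
  | mem c h =>
    obtain ⟨ξ, η, rfl⟩ := h
    exact ⟨𝓤.crossedInner ξ η, Submodule.subset_span ⟨_, _, rfl⟩, fun w => rfl⟩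
  | zero => exact ⟨0, zero_mem _, fun w => rfl⟩
  | add c d _ _ h1 h2 =>
    obtain ⟨g, hg, hgc⟩ := h1
    obtain ⟨h, hh, hhd⟩ := h2
    exact ⟨g + h, add_mem hg hh, fun w => by simp [hgc, hhd]⟩
  | smul z c _ h =>
    obtain ⟨g, hg, hgc⟩ := h
    exact ⟨z • g, SMulMemClass.smul_mem z hg, fun w => by simp [hgc]⟩

/-- Replacing `ξ` by `b^* ξ` in the first variable multiplies every coefficient of `⟪ξ | η⟫` by `b`.
This is the module property needed for the partition of unity argument. -/
theorem mk_mul_mem_innerSpan (b : C₀(X, ℂ)) {g : CrossedProduct T} (hg : g ∈ 𝓤.innerSpan) :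
    CrossedProduct.mk (fun w => b * g.coeff w) ∈ 𝓤.innerSpan := by
  change g ∈ Submodule.span ℂ _ at hg
  induction hg using Submodule.span_induction with
  | mem g h =>
    obtain ⟨ξ, η, rfl⟩ := h
    refine Submodule.subset_span ⟨star b • ξ, η, ?_⟩
    ext w x
    rw [crossedInner_coeff, CStarModule.inner_op_smul_left, star_star, mul_comm]
    rfl
  | zero =>
    convert zero_mem 𝓤.innerSpan using 1
    ext w x
    simp
  | add g h _ _ h1 h2 =>
    convert add_mem h1 h2 using 1
    ext w x
    simp [mul_add]
  | smul c g _ h =>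
    convert SMulMemClass.smul_mem c h using 1
    ext w x
    simp [mul_left_comm]

theorem mem_idealCXEW_iff [LocallyCompactSpace X] [T2Space X] (h𝓤 : 𝓤.CompletenessCondition)
    (f : CrossedProduct T) : f ∈ 𝓤.idealCXEW ↔
      ∀ x : X, ∀ w' ∈ 𝓤.scalarGroup x, ∀ w : W,
        f.coeff (w' * w) x = 𝓤.iota w' x * T.γ w' w x * f.coeff w x := by
  refine ⟨fun hf x w' hw' w => 𝓤.coeff_mul_of_mem_idealCXEW hf hw' w, fun hf => ?_⟩
  let S : Submodule ℂ (W → C₀(X, ℂ)) :=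
    { carrier := {g | (CrossedProduct.mk g : CrossedProduct T) ∈ 𝓤.innerSpan}
      add_mem' := fun ha hb => 𝓤.innerSpan.add_mem' ha hb
      zero_mem' := zero_mem 𝓤.innerSpan
      smul_mem' := fun c _ ha => 𝓤.innerSpan.smul_mem' c ha }
  have h := mem_closure_of_forall_apply S (fun b g hg => 𝓤.mk_mul_mem_innerSpan b hg)
    (fun w => f.coeff w) fun x => 𝓤.exists_mem_innerSpan_coeff_apply x
      (𝓤.mem_span_inner_apply h𝓤 x (fun w => f.coeff w x) (hf x))
  exact map_mem_closure (CrossedProduct.continuous_mk (T := T)) h fun g hg => hg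

/-! ### The right Hilbert module structure -/

theorem crossedInner_add_right (ξ η ζ : E) :
    𝓤.crossedInner ξ (η + ζ) = 𝓤.crossedInner ξ η + 𝓤.crossedInner ξ ζ := by
  ext w x
  simp [crossedInner_coeff]

theorem crossedInner_smul_right (c : ℂ) (ξ η : E) :
    𝓤.crossedInner ξ (c • η) = c • 𝓤.crossedInner ξ η := by
  ext w x
  simp [crossedInner_coeff]

theorem crossedInner_coeff_one (ξ η : E) :
    (𝓤.crossedInner ξ η).coeff 1 = inner C₀(X, ℂ) ξ η := by
  rw [crossedInner_coeff, U_one]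

/-- The coefficient at `1` recovers the original inner product. The laws of the right action then
follow from the ring laws of the crossed product through `crossedInner_mul`. -/
theorem crossedInner_ext {η η' : E} (h : ∀ ζ, 𝓤.crossedInner ζ η = 𝓤.crossedInner ζ η') :
    η = η' :=
  ext_inner C₀(X, ℂ) fun ζ => by
    rw [← 𝓤.crossedInner_coeff_one, ← 𝓤.crossedInner_coeff_one, h]

theorem crossedInner_act_left (ξ η : E) (f : CrossedProduct T) :
    𝓤.crossedInner (𝓤.crossedAct ξ f) η = star f * 𝓤.crossedInner ξ η := by
  rw [← star_crossedInner, ← crossedInner_mul, star_mul, star_crossedInner]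

theorem crossedAct_add_left (ξ η : E) (f : CrossedProduct T) :
    𝓤.crossedAct (ξ + η) f = 𝓤.crossedAct ξ f + 𝓤.crossedAct η f :=
  𝓤.crossedInner_ext fun ζ => by
    simp only [crossedInner_add_right, ← crossedInner_mul, add_mul]

theorem crossedAct_smul_left (c : ℂ) (ξ : E) (f : CrossedProduct T) :
    𝓤.crossedAct (c • ξ) f = c • 𝓤.crossedAct ξ f :=
  𝓤.crossedInner_ext fun ζ => by
    simp only [crossedInner_smul_right, ← crossedInner_mul, smul_mul_assoc]

theorem crossedAct_add_right (ξ : E) (f g : CrossedProduct T) :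
    𝓤.crossedAct ξ (f + g) = 𝓤.crossedAct ξ f + 𝓤.crossedAct ξ g :=
  𝓤.crossedInner_ext fun ζ => by
    simp only [crossedInner_add_right, ← crossedInner_mul, mul_add]

theorem crossedAct_smul_right (c : ℂ) (ξ : E) (f : CrossedProduct T) :
    𝓤.crossedAct ξ (c • f) = c • 𝓤.crossedAct ξ f :=
  𝓤.crossedInner_ext fun ζ => by
    simp only [crossedInner_smul_right, ← crossedInner_mul, mul_smul_comm]

theorem crossedAct_mul (ξ : E) (f g : CrossedProduct T) :
    𝓤.crossedAct ξ (f * g) = 𝓤.crossedAct (𝓤.crossedAct ξ f) g :=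
  𝓤.crossedInner_ext fun ζ => by
    simp only [← crossedInner_mul, mul_assoc]

/-! ### Completeness, positivity and fullness for the right inner product -/

theorem norm_le_sqrt_norm_crossedInner (ξ : E) : ‖ξ‖ ≤ √‖𝓤.crossedInner ξ ξ‖ := by
  rw [CStarModule.norm_eq_sqrt_norm_inner_self (A := C₀(X, ℂ)) ξ, ← 𝓤.crossedInner_coeff_one]
  exact Real.sqrt_le_sqrt (CrossedProduct.norm_coeff_le _ _)

theorem continuous_crossedInner_self : Continuous fun ξ : E => 𝓤.crossedInner ξ ξ :=
  CrossedProduct.continuous_mk.comp <| continuous_pi fun w =>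
    (CStarModule.continuous_inner (A := C₀(X, ℂ)) (E := E)).comp
      (continuous_id.prodMk (𝓤.U w).continuous)

/-- The new norm dominates the given one, so Cauchy sequences converge in `E`; conversely `ξ ↦ ⟪ξ |
ξ⟫` is continuous because `W` is finite, so they also converge in the new norm. -/
theorem exists_tendsto_of_cauchy [CompleteSpace E] (u : ℕ → E)
    (hu : ∀ ε > 0, ∃ N, ∀ m ≥ N, ∀ n ≥ N, √‖𝓤.crossedInner (u m - u n) (u m - u n)‖ < ε) :
    ∃ ξ, Filter.Tendsto (fun n => √‖𝓤.crossedInner (u n - ξ) (u n - ξ)‖)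
      Filter.atTop (nhds 0) := by
  have hc : CauchySeq u := Metric.cauchySeq_iff.mpr fun ε hε => by
    obtain ⟨N, hN⟩ := hu ε hε
    refine ⟨N, fun m hm n hn => ?_⟩
    rw [dist_eq_norm]
    exact (𝓤.norm_le_sqrt_norm_crossedInner _).trans_lt (hN m hm n hn)
  obtain ⟨ξ, hξ⟩ := cauchySeq_tendsto_of_complete hc
  refine ⟨ξ, ?_⟩
  have h1 : Filter.Tendsto (fun n => u n - ξ) Filter.atTop (nhds 0) := by
    simpa using hξ.sub_const ξ
  have h2 := ((Real.continuous_sqrt.comp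
    (continuous_norm.comp 𝓤.continuous_crossedInner_self)).tendsto 0).comp h1
  have h3 : 𝓤.crossedInner (0 : E) 0 = 0 := by
    ext w x
    simp [crossedInner_coeff]
  simpa [Function.comp_def, h3] using h2

theorem star_mul_self_coeff_one (f : CrossedProduct T) (x : X) :
    (star f * f).coeff 1 x = ∑ w, ((‖f.coeff w⁻¹ (w⁻¹ • x)‖ ^ 2 : ℝ) : ℂ) := by
  rw [CrossedProduct.mul_coeff]
  refine Finset.sum_congr rfl fun w _ => ?_
  rw [CrossedProduct.star_coeff, mul_one]
  have h1 : (T.γ w w⁻¹ x : ℂ) * starRingEnd ℂ (T.γ w w⁻¹ x : ℂ) = 1 := by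
    rw [Complex.mul_conj, Circle.normSq_coe, Complex.ofReal_one]
  have h2 := Complex.conj_mul' (f.coeff w⁻¹ (w⁻¹ • x))
  push_cast
  linear_combination (starRingEnd ℂ (f.coeff w⁻¹ (w⁻¹ • x)) * f.coeff w⁻¹ (w⁻¹ • x)) * h1 + h2

/-- Compare coefficients at `1`: on the left stands `⟨ξ | ξ⟩ ≥ 0`, on the right minus a sum of
squares of absolute values in which every coefficient of `f` occurs. -/
theorem eq_zero_of_crossedInner_eq_neg {ξ : E} {f : CrossedProduct T}
    (h : 𝓤.crossedInner ξ ξ = -(star f * f)) : f = 0 := by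
  ext w x
  have h1 := congrArg (fun g : CrossedProduct T => (g.coeff 1 (w⁻¹ • x)).re) h
  simp only [crossedInner_coeff_one, CrossedProduct.coeff_neg, ZeroAtInftyContinuousMap.neg_apply,
    star_mul_self_coeff_one, Complex.neg_re, Complex.re_sum, Complex.ofReal_re] at h1
  have h2 : 0 ≤ (inner C₀(X, ℂ) ξ ξ (w⁻¹ • x)).re := inner_self_apply_nonneg ξ _
  have h3 := Finset.single_le_sum (s := Finset.univ)
    (f := fun v => ‖f.coeff v⁻¹ (v⁻¹ • w⁻¹ • x)‖ ^ 2) (fun v _ => by positivity)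
    (Finset.mem_univ w⁻¹)
  simp only [inv_inv, smul_inv_smul] at h3
  have h4 : ‖f.coeff w x‖ ^ 2 = 0 := le_antisymm (by linarith) (by positivity)
  simpa using h4

/-- For self-adjoint `b` one has `b ⟪ξ | ξ⟫ b = ⟪ξb | ξb⟫`, so the positivity criterion applies. It
is used inside the ideal itself, which places the factor `b` of the conclusion there. -/
theorem exists_crossedInner_eq_star_mul (ξ : E) :
    ∃ b : 𝓤.idealCXEW, (⟨𝓤.crossedInner ξ ξ, 𝓤.crossedInner_mem ξ ξ⟩ : 𝓤.idealCXEW) =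
      star b * b := by
  refine exists_eq_star_mul_self_of_conjugate (Subtype.ext (𝓤.star_crossedInner ξ ξ))
    fun b c hb h => Subtype.ext ?_
  have h1 : b.1 * 𝓤.crossedInner ξ ξ * b.1 = -(star c.1 * c.1) := congrArg Subtype.val h
  have h2 : star b.1 = b.1 := congrArg Subtype.val hb.star_eq
  refine 𝓤.eq_zero_of_crossedInner_eq_neg (ξ := 𝓤.crossedAct ξ b.1) ?_
  rw [← h1, crossedInner_act_left, ← crossedInner_mul, h2, mul_assoc]

theorem closure_span_crossedInner :
    closure (Submodule.span ℂ {b : 𝓤.idealCXEW | ∃ ξ η,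
      b = ⟨𝓤.crossedInner ξ η, 𝓤.crossedInner_mem ξ η⟩} : Set 𝓤.idealCXEW) = Set.univ := by
  refine Set.eq_univ_of_forall fun b => ?_
  rw [closure_subtype]
  refine closure_mono (fun f hf => ?_) b.2
  change f ∈ Submodule.span ℂ _ at hf
  induction hf using Submodule.span_induction with
  | mem f h =>
    obtain ⟨ξ, η, rfl⟩ := h
    exact ⟨_, Submodule.subset_span ⟨ξ, η, rfl⟩, rfl⟩
  | zero => exact ⟨0, Submodule.zero_mem _, rfl⟩
  | add f g _ _ h1 h2 =>
    obtain ⟨f', hf, rfl⟩ := h1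
    obtain ⟨g', hg, rfl⟩ := h2
    exact ⟨f' + g', Submodule.add_mem _ hf hg, rfl⟩
  | smul c f _ h =>
    obtain ⟨f', hf, rfl⟩ := h
    exact ⟨c • f', Submodule.smul_mem _ c hf, rfl⟩

end TwistedModuleAction

namespace TwistedModuleAction

variable {W X : Type*} [Group W] [TopologicalSpace X] [MulAction W X]
  [ContinuousConstSMul W X] {T : TwistedAction W X} {E : Type*} [NormedAddCommGroup E]
  [NormedSpace ℂ E] [SMul C₀(X, ℂ) E] [CStarModule C₀(X, ℂ) E] (𝓤 : TwistedModuleAction T E)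

/-! ### The left inner product -/

theorem adjointable_smul (S : adjointable C₀(X, ℂ) E) (b : C₀(X, ℂ)) (ξ : E) :
    S.1 (b • ξ) = b • S.1 ξ :=
  ext_inner C₀(X, ℂ) fun ζ => by
    rw [inner_apply_right, CStarModule.inner_op_smul_right, CStarModule.inner_op_smul_right,
      inner_apply_right]

theorem inner_symm_smul_symm (w : W) (ξ η ζ : E) :
    inner C₀(X, ℂ) ((𝓤.U w).symm η) ζ • (𝓤.U w).symm ξ =
      (𝓤.U w).symm (inner C₀(X, ℂ) η (𝓤.U w ζ) • ξ) := by
  apply (𝓤.U w).injective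
  rw [𝓤.U_smul, ContinuousLinearEquiv.apply_symm_apply, ContinuousLinearEquiv.apply_symm_apply,
    ← 𝓤.inner_U, ContinuousLinearEquiv.apply_symm_apply]

variable [Fintype W]

/-- The operator `ζ ↦ ξ · ⟪η | ζ⟫` as a sum of operators of rank one. -/
def averagedRankOne (ξ η : E) : adjointable C₀(X, ℂ) E :=
  ∑ w, rankOne C₀(X, ℂ) ((𝓤.U w).symm ξ) ((𝓤.U w).symm η)

theorem coe_averagedRankOne (ξ η : E) : (𝓤.averagedRankOne ξ η).1 =
    ∑ w, rankOneCLM C₀(X, ℂ) ((𝓤.U w).symm ξ) ((𝓤.U w).symm η) :=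
  map_sum (adjointable C₀(X, ℂ) E).subtype _ _

theorem averagedRankOne_apply (ξ η ζ : E) :
    (𝓤.averagedRankOne ξ η).1 ζ = 𝓤.crossedAct ξ (𝓤.crossedInner η ζ) := by
  rw [coe_averagedRankOne, _root_.sum_apply, crossedAct]
  exact Finset.sum_congr rfl fun w _ => 𝓤.inner_symm_smul_symm w ξ η ζ

/-- The substitution `w = uv` matches the terms; the phase `γ(u,v)` from `U_u U_v` is the same
inside and outside the inner product and cancels. -/
theorem U_crossedAct_crossedInner (v : W) (ξ η ζ : E) :
    𝓤.U v (𝓤.crossedAct ξ (𝓤.crossedInner η ζ)) =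
      𝓤.crossedAct ξ (𝓤.crossedInner η (𝓤.U v ζ)) := by
  rw [crossedAct, crossedAct, map_sum]
  refine Fintype.sum_equiv (Equiv.mulRight v⁻¹) _ _ fun w => ?_
  obtain ⟨u, rfl⟩ : ∃ u, w = u * v := ⟨w * v⁻¹, by group⟩
  simp only [Equiv.coe_mulRight, mul_inv_cancel_right, crossedInner_coeff]
  apply (𝓤.U u).injective
  rw [ContinuousLinearEquiv.apply_symm_apply]
  refine ext_inner C₀(X, ℂ) fun θ => ZeroAtInftyContinuousMap.ext fun x => ?_
  have h0 : (T.γ u v x : ℂ) ≠ 0 := Circle.coe_ne_zero _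
  apply mul_left_cancel₀ h0
  rw [inner_U_U, ContinuousLinearEquiv.apply_symm_apply, CStarModule.inner_op_smul_right,
    CStarModule.inner_op_smul_right, ZeroAtInftyContinuousMap.mul_apply,
    ZeroAtInftyContinuousMap.mul_apply, ← inner_U_U, mul_assoc]

theorem averagedRankOne_star (ξ η : E) :
    star (𝓤.averagedRankOne ξ η) = 𝓤.averagedRankOne η ξ := by
  simp only [averagedRankOne, star_sum, star_rankOne]

theorem inner_averagedRankOne_self (ξ ζ : E) :
    inner C₀(X, ℂ) ζ ((𝓤.averagedRankOne ξ ξ).1 ζ) =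
      ∑ w, star (inner C₀(X, ℂ) ((𝓤.U w).symm ξ) ζ) * inner C₀(X, ℂ) ((𝓤.U w).symm ξ) ζ := by
  rw [coe_averagedRankOne, _root_.sum_apply, CStarModule.inner_sum_right]
  refine Finset.sum_congr rfl fun w _ => ?_
  rw [rankOneCLM_apply, CStarModule.inner_op_smul_right, CStarModule.star_inner, mul_comm]

theorem inner_averagedRankOne_self_nonneg (ξ ζ : E) :
    0 ≤ inner C₀(X, ℂ) ζ ((𝓤.averagedRankOne ξ ξ).1 ζ) := by
  rw [inner_averagedRankOne_self]
  exact Finset.sum_nonneg fun w _ => star_mul_self_nonneg _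

theorem eq_zero_of_averagedRankOne_self_eq_zero {ξ : E} (h : 𝓤.averagedRankOne ξ ξ = 0) :
    ξ = 0 := by
  have h1 := 𝓤.inner_averagedRankOne_self ξ ξ
  have h2 : (𝓤.averagedRankOne ξ ξ).1 ξ = 0 := by rw [h]; rfl
  rw [h2, CStarModule.inner_zero_right] at h1
  have h3 := (Finset.sum_eq_zero_iff_of_nonneg fun w _ => star_mul_self_nonneg _).mp h1.symm 1
    (Finset.mem_univ 1)
  have h4 : (𝓤.U 1).symm ξ = ξ := by
    rw [ContinuousLinearEquiv.symm_apply_eq, U_one]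
  rw [h4, CStarRing.star_mul_self_eq_zero_iff, CStarModule.inner_self] at h3
  exact h3

theorem crossedAct_apply {k : adjointable C₀(X, ℂ) E}
    (hk : ∀ (w : W) (ξ : E), 𝓤.U w (k.1 ξ) = k.1 (𝓤.U w ξ)) (ξ : E) (f : CrossedProduct T) :
    𝓤.crossedAct (k.1 ξ) f = k.1 (𝓤.crossedAct ξ f) := by
  rw [crossedAct, crossedAct, map_sum]
  refine Finset.sum_congr rfl fun w _ => ?_
  apply (𝓤.U w).injective
  rw [hk, ContinuousLinearEquiv.apply_symm_apply, ContinuousLinearEquiv.apply_symm_apply,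
    adjointable_smul]

theorem crossedInner_apply_left {k : adjointable C₀(X, ℂ) E}
    (hk : ∀ (w : W) (ξ : E), 𝓤.U w ((star k).1 ξ) = (star k).1 (𝓤.U w ξ)) (ξ η : E) :
    𝓤.crossedInner (k.1 ξ) η = 𝓤.crossedInner ξ ((star k).1 η) := by
  ext w x
  rw [crossedInner_coeff, crossedInner_coeff, hk, inner_apply_left]

/-! ### Invariant compact operators: positivity and fullness of the left inner product -/

variable [CompleteSpace E]

/-- The left inner product of `E` with values in the `W`-invariant compact operators. -/
def leftInner (ξ η : E) : 𝓤.fixedCompacts :=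
  ⟨𝓤.averagedRankOne ξ η, subset_closure (sum_mem fun w _ => Submodule.subset_span ⟨_, _, rfl⟩),
    fun w ζ => by
      rw [averagedRankOne_apply, averagedRankOne_apply, U_crossedAct_crossedInner]⟩

theorem leftInner_apply (ξ η ζ : E) :
    (𝓤.leftInner ξ η).1.1 ζ = 𝓤.crossedAct ξ (𝓤.crossedInner η ζ) :=
  𝓤.averagedRankOne_apply ξ η ζ

theorem fixedCompacts_ext {k l : 𝓤.fixedCompacts} (h : ∀ ζ, k.1.1 ζ = l.1.1 ζ) : k = l :=
  Subtype.ext (Subtype.ext (ContinuousLinearMap.ext h))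

theorem leftInner_star (ξ η : E) : star (𝓤.leftInner ξ η) = 𝓤.leftInner η ξ :=
  Subtype.ext (𝓤.averagedRankOne_star ξ η)

theorem leftInner_act (k : 𝓤.fixedCompacts) (ξ η : E) :
    𝓤.leftInner (k.1.1 ξ) η = k * 𝓤.leftInner ξ η :=
  𝓤.fixedCompacts_ext fun ζ => by
    rw [leftInner_apply, 𝓤.crossedAct_apply k.2.2, ← leftInner_apply]
    rfl

/-- Conjugating by `b` replaces `ξ` by `bξ`, which again gives an operator with nonnegative
quadratic form. If this operator is `-c^*c`, then `⟨cζ | cζ⟩ ≤ 0` for all `ζ`, so `c = 0`. -/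
theorem exists_leftInner_eq_star_mul (ξ : E) :
    ∃ k : 𝓤.fixedCompacts, 𝓤.leftInner ξ ξ = star k * k := by
  refine exists_eq_star_mul_self_of_conjugate (𝓤.leftInner_star ξ ξ) fun b c hb h => ?_
  have h1 : 𝓤.leftInner (b.1.1 ξ) (b.1.1 ξ) = -(star c * c) := by
    rw [leftInner_act, ← 𝓤.leftInner_star (b.1.1 ξ) ξ, leftInner_act, star_mul, leftInner_star,
      hb.star_eq, ← mul_assoc, h]
  refine 𝓤.fixedCompacts_ext fun ζ => ?_
  have h2 := 𝓤.inner_averagedRankOne_self_nonneg (b.1.1 ξ) ζ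
  have h3 : (𝓤.averagedRankOne (b.1.1 ξ) (b.1.1 ξ)).1 ζ = -((star c.1).1 (c.1.1 ζ)) :=
    congrArg (fun k : 𝓤.fixedCompacts => k.1.1 ζ) h1
  rw [h3, CStarModule.inner_neg_right, ← inner_apply_left, neg_nonneg] at h2
  exact CStarModule.inner_self.mp (le_antisymm h2 CStarModule.inner_self_nonneg)

theorem closure_span_leftInner :
    closure (Submodule.span ℂ {k | ∃ ξ η, k = 𝓤.leftInner ξ η} : Set 𝓤.fixedCompacts) =
      Set.univ := by
  refine Set.eq_univ_of_forall fun k => ?_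
  let j : 𝓤.fixedCompacts →ₗ[ℂ] (E →L[ℂ] E) :=
    { toFun := fun k => k.1.1, map_add' := fun _ _ => rfl, map_smul' := fun _ _ => rfl }
  have hj : Topology.IsInducing j :=
    Topology.IsInducing.subtypeVal.comp Topology.IsInducing.subtypeVal
  let L : Submodule ℂ (E →L[ℂ] E) := (Submodule.span ℂ {k | ∃ ξ η, k = 𝓤.leftInner ξ η}).map j
  rw [hj.closure_eq_preimage_closure_image]
  change j k ∈ L.topologicalClosure
  -- The unnormalised average over `W` takes `|ξ⟩⟨η|` to the left inner product of `ξ` and `η`, and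
  -- multiplies invariant operators by `|W|`. Being continuous, it carries a finite-rank
  -- approximation of `k` to an approximation of `|W| k` by left inner products.
  let Φ : (E →L[ℂ] E) → (E →L[ℂ] E) := fun A =>
    ∑ w, ((𝓤.U w).symm : E →L[ℂ] E) ∘L A ∘L (𝓤.U w : E →L[ℂ] E)
  have hΦ : Continuous Φ := by fun_prop
  have hk : (k.1.1 : E →L[ℂ] E) ∈ closure
      (Subtype.val '' (finiteRank C₀(X, ℂ) E : Set (adjointable C₀(X, ℂ) E))) := by
    have := k.2.1
    exact image_closure_subset_closure_image continuous_subtype_val ⟨k.1, this, rfl⟩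
  have h1 : Φ (j k) ∈ L.topologicalClosure := by
    refine map_mem_closure hΦ hk ?_
    rintro _ ⟨A, hA, rfl⟩
    change A ∈ Submodule.span ℂ _ at hA
    change Φ A.1 ∈ L
    induction hA using Submodule.span_induction with
    | mem A h =>
      obtain ⟨ξ, η, rfl⟩ := h
      refine ⟨_, Submodule.subset_span ⟨ξ, η, rfl⟩, ?_⟩
      refine (𝓤.coe_averagedRankOne ξ η).trans (Finset.sum_congr rfl fun w _ => ?_)
      ext ζ
      exact 𝓤.inner_symm_smul_symm w ξ η ζ
    | zero =>
      convert L.zero_mem using 1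
      exact Finset.sum_eq_zero fun w _ => by ext ζ; simp
    | add A B _ _ h1 h2 =>
      convert L.add_mem h1 h2 using 1
      ext ζ
      simp [Φ, Finset.sum_add_distrib]
    | smul c A _ h =>
      convert L.smul_mem c h using 1
      ext ζ
      simp [Φ, Finset.smul_sum]
  have h2 : Φ (j k) = (Fintype.card W : ℂ) • j k := by
    ext ζ
    simp only [Φ, _root_.sum_apply, _root_.smul_apply]
    rw [Nat.cast_smul_eq_nsmul, ← Finset.card_univ, ← Finset.sum_const]
    refine Finset.sum_congr rfl fun w _ => ?_
    change (𝓤.U w).symm (k.1.1 (𝓤.U w ζ)) = k.1.1 ζ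
    rw [← k.2.2, ContinuousLinearEquiv.symm_apply_apply]
  rw [h2] at h1
  exact (Submodule.smul_mem_iff _ (Nat.cast_ne_zero.mpr Fintype.card_ne_zero)).mp h1

/-- `E` as a Morita equivalence between `K_{C₀(X)}(E)^W` and `C(X, E, W)`. -/
def moritaEquivalence : MoritaEquivalence 𝓤.fixedCompacts 𝓤.idealCXEW E where
  lact := LinearMap.mk₂ ℂ (fun k ξ => k.1.1 ξ) (fun _ _ _ => rfl) (fun _ _ _ => rfl)
    (fun k ξ η => map_add k.1.1 ξ η) (fun c k ξ => map_smul k.1.1 c ξ)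
  ract := LinearMap.mk₂ ℂ (fun ξ f => 𝓤.crossedAct ξ f.1)
    (fun ξ η f => 𝓤.crossedAct_add_left ξ η f.1) (fun c ξ f => 𝓤.crossedAct_smul_left c ξ f.1)
    (fun ξ f g => 𝓤.crossedAct_add_right ξ f.1 g.1) (fun c ξ f => 𝓤.crossedAct_smul_right c ξ f.1)
  linner := 𝓤.leftInner
  rinner ξ η := ⟨𝓤.crossedInner ξ η, 𝓤.crossedInner_mem ξ η⟩
  lact_mul _ _ _ := rfl
  ract_mul ξ f g := 𝓤.crossedAct_mul ξ f.1 g.1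
  lact_ract k ξ f := 𝓤.crossedAct_apply k.2.2 ξ f.1
  linner_add ξ ξ' η := 𝓤.fixedCompacts_ext fun ζ => by
    rw [leftInner_apply, crossedAct_add_left, ← leftInner_apply, ← leftInner_apply]
    rfl
  linner_smul c ξ η := 𝓤.fixedCompacts_ext fun ζ => by
    rw [leftInner_apply, crossedAct_smul_left, ← leftInner_apply]
    rfl
  linner_lact k ξ η := 𝓤.leftInner_act k ξ η
  linner_star := 𝓤.leftInner_star
  linner_pos := 𝓤.exists_leftInner_eq_star_mul
  linner_definite ξ h := 𝓤.eq_zero_of_averagedRankOne_self_eq_zero (congrArg Subtype.val h)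
  rinner_add ξ η η' := Subtype.ext (𝓤.crossedInner_add_right ξ η η')
  rinner_smul c ξ η := Subtype.ext (𝓤.crossedInner_smul_right c ξ η)
  rinner_ract ξ η f := Subtype.ext (𝓤.crossedInner_mul ξ η f.1).symm
  rinner_star ξ η := Subtype.ext (𝓤.star_crossedInner ξ η)
  rinner_pos := 𝓤.exists_crossedInner_eq_star_mul
  rinner_definite ξ h := by
    rw [← CStarModule.inner_self (A := C₀(X, ℂ)), ← 𝓤.crossedInner_coeff_one]
    exact congrArg (fun f : 𝓤.idealCXEW => f.1.coeff 1) h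
  linner_ract ξ η f := 𝓤.fixedCompacts_ext fun ζ => by
    rw [leftInner_apply, leftInner_apply]
    change 𝓤.crossedAct (𝓤.crossedAct ξ f.1) _ =
      𝓤.crossedAct ξ (𝓤.crossedInner (𝓤.crossedAct η (star f.1)) ζ)
    rw [crossedInner_act_left, star_star, crossedAct_mul]
  rinner_lact k ξ η := Subtype.ext (𝓤.crossedInner_apply_left (star k).2.2 ξ η)
  imprimitivity := 𝓤.leftInner_apply
  linner_full := 𝓤.closure_span_leftInner
  rinner_full := 𝓤.closure_span_crossedInner
  complete := 𝓤.exists_tendsto_of_cauchy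

end TwistedModuleAction

end TwistedMorita
end

theorem mainTheorem3 {X : Type*} [TopologicalSpace X] [LocallyCompactSpace X] [T2Space X]
    {W : Type*} [Group W] [Fintype W] [MulAction W X] [ContinuousConstSMul W X]
    (T : TwistedMorita.TwistedAction W X)
    {E : Type*} [NormedAddCommGroup E] [NormedSpace ℂ E] [CompleteSpace E]
    [SMul C₀(X, ℂ) E] [CStarModule C₀(X, ℂ) E]
    (𝓤 : TwistedMorita.TwistedModuleAction T E) (h𝓤 : 𝓤.CompletenessCondition) :
    (∀ f : TwistedMorita.CrossedProduct T, f ∈ 𝓤.idealCXEW ↔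
      ∀ x : X, ∀ w' ∈ 𝓤.scalarGroup x, ∀ w : W,
        f.coeff (w' * w) x = 𝓤.iota w' x * T.γ w' w x * f.coeff w x) ∧
    (∀ f ∈ 𝓤.idealCXEW, ∀ g : TwistedMorita.CrossedProduct T,
      f * g ∈ 𝓤.idealCXEW ∧ g * f ∈ 𝓤.idealCXEW) ∧
    ∃ M : TwistedMorita.MoritaEquivalence 𝓤.fixedCompacts 𝓤.idealCXEW E,
      (∀ (k : 𝓤.fixedCompacts) (ξ : E), M.lact k ξ = k.1.1 ξ) ∧
      (∀ (ξ : E) (f : 𝓤.idealCXEW), M.ract ξ f = 𝓤.crossedAct ξ f.1) ∧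
      (∀ ξ η : E, (M.rinner ξ η).1 = 𝓤.crossedInner ξ η) :=
  ⟨𝓤.mem_idealCXEW_iff h𝓤,
    fun _ hf g => ⟨𝓤.mul_mem_idealCXEW_right hf g, 𝓤.mul_mem_idealCXEW_left hf g⟩,
    𝓤.moritaEquivalence, fun _ _ => rfl, fun _ _ => rfl, fun _ _ => rfl⟩
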